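/- **Setting.** Let $S$ be one of the ten symmetry types A, D, C, AI, AII, AIII, BDI, CI, CII, DIII. A representation of $S$ on a Hilbert space consists of those operators among $\eta$ (particle-hole, antiunitary), $\tau$ (time reversal, antiunitary), $\gamma$ (chiral, unitary) that belong to $S$, with squares as follows. D: $\eta^2=1$. C: $\eta^2=-1$. AI: $\tau^2=1$. AII: $\tau^2=-1$. AIII: $\gamma^2=1$. Type A has no symmetry. The other four types contain all three operators, with $\eta\tau=\tau\eta=\gamma$ and $(\eta^2,\tau^2)=(1,1)$ for BDI, $(-1,1)$ for CI, $(-1,-1)$ for CII, $(1,-1)$ for DIII. A bounded operator $W$ *satisfies the symmetries* if $\eta W\eta^{*}=W$, $\tau W\tau^{*}=W^{*}$, $\gamma W\gamma^{*}=W^{*}$ for the symmetries in $S$. It is *gapped* if $\pm1$ are in its resolvent set, and *essentially gapped* if $\pm1$ are not in the spectrum of its image in the Calkin algebra. A finite-dimensional representation is *balanced* if some gapped unitary on it satisfies its symmetries. The *index group* $I(S)$ is the universal abelian group with an invariant $\mathrm{si}(\rho)$ of finite-dimensional representations up to unitary equivalence that is additive under direct sums and vanishes on balanced representations. The *absolute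 value* of an index is computed through the homomorphism from $I(S)$ that sends $\mathrm{si}(\rho)$ to $\dim\rho \bmod 2$ (type D), to $\dim\rho \bmod 4$ (type DIII, values $0,2$), to $\operatorname{tr}\gamma\in\mathbb Z$ (types AIII, BDI, CII), and to $0$ for the other types. Let $\mathcal H=\bigoplus_{x\in\mathbb Z}\mathcal H_x$ with cells $\mathcal H_x$ of finite nonzero dimension carry a representation of $S$ that leaves every cell invariant and is balanced in every cell. Let $P_{\ge a}$ and $P_{<a}=1-P_{\ge a}$ be the projections onto $\bigoplus_{x\ge a}\mathcal H_x$ and $\bigoplus_{x<a}\mathcal H_x$. An *admissible walk* is an essentially gapped unitary $W$ on $\mathcal H$ that satisfies the symmetries and is essentially local, that is, $P_{\ge a}-W^{*}P_{\ge a}W$ is compact for some $a$. A *bulk walk* is an admissible walk that is gapped. For an admissible walk let $\mathrm{si}(W)=\mathrm{si}_+(W)+\mathrm{si}_-(W)$, where $\mathrm{si}_\pm(W)$ is the index of the representation on the (finite-dimensional) eigenspace $\ker(W\mp1)$. Its left and right indices at the cut point $a$, $\overleftarrow{\mathrm{si}}_a(W)$ and $\overrightarrow{\mathrm{si}}_a(W)$,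 are the indices of the (finite-dimensional) representations on the $0$-eigenspaces of $\frac1{2i}(T-T^{*})$ for $T=P_{<a}WP_{<a}$ on $P_{<a}\mathcal H$ and $T=P_{\ge a}WP_{\ge a}$ on $P_{\ge a}\mathcal H$, respectively. **Corollary (Bulk-boundary correspondence).** Let $W_L$ and $W_R$ be bulk walks on $\mathcal H$, and let $W$ be a unitary operator on $\mathcal H$ that satisfies the symmetries and is a crossover of the two, that is, $$\lim_{a\to+\infty}\|P_{\ge a}(W-W_R)P_{\ge a}\|=0,\qquad \lim_{a\to-\infty}\|P_{<a}(W-W_L)P_{<a}\|=0 .$$ Then $W$ is an admissible walk, all the indices below are defined (the subspaces involved are finite-dimensional and invariant under the symmetries), and for all cut points $a,b,c,d\in\mathbb Z$ $$\mathrm{si}(W)=\overleftarrow{\mathrm{si}}_a(W)+\overrightarrow{\mathrm{si}}_b(W)=-\overrightarrow{\mathrm{si}}_c(W_L)+\overrightarrow{\mathrm{si}}_d(W_R).$$ If $\overrightarrow{\mathrm{si}}_c(W_L)\neq\overrightarrow{\mathrm{si}}_d(W_R)$, then $\mathrm{si}(W)\neq0$, and $W$ has an eigenvector with eigenvalue $+1$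 or $-1$. Moreover, the absolute value of $-\overrightarrow{\mathrm{si}}_c(W_L)+\overrightarrow{\mathrm{si}}_d(W_R)$ is a lower bound for $\dim\bigl(\ker(W-1)\oplus\ker(W+1)\bigr)$. -/

import Mathlib

open Filter Topology
open scoped InnerProductSpace

universe u

noncomputable section

namespace QWalk

/-! ### The tenfold way -/

/-- The three kinds of involutive symmetries: particle-hole `eta`, time reversal `tau`,
chiral `gamma`. -/
inductive SymKind
  | eta
  | tau
  | gamma

/-- The ten symmetry types, by their Cartan labels. -/
inductive SymType
  | A
  | D
  | C
  | AI
  | AII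
  | AIII
  | BDI
  | CI
  | CII
  | DIII

/-- The scalar action accompanying a symmetry: `eta` and `tau` are antilinear, `gamma` is linear. -/
def SymKind.twist : SymKind → (ℂ →+* ℂ)
  | .eta => starRingEnd ℂ
  | .tau => starRingEnd ℂ
  | .gamma => RingHom.id ℂ

/-- The sign of the square of each symmetry; the value `0` encodes that this symmetry
is not part of the type. -/
def SymType.sq : SymType → SymKind → ℤ
  | .A, _ => 0
  | .D, .eta => 1
  | .D, _ => 0
  | .C, .eta => -1
  | .C, _ => 0
  | .AI, .tau => 1
  | .AI, _ => 0
  | .AII, .tau => -1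
  | .AII, _ => 0
  | .AIII, .gamma => 1
  | .AIII, _ => 0
  | .BDI, .eta => 1
  | .BDI, .tau => 1
  | .BDI, .gamma => 1
  | .CI, .eta => -1
  | .CI, .tau => 1
  | .CI, .gamma => -1
  | .CII, .eta => -1
  | .CII, .tau => -1
  | .CII, .gamma => 1
  | .DIII, .eta => 1
  | .DIII, .tau => -1
  | .DIII, .gamma => -1

/-- The symmetry `k` belongs to the type `S`. -/
def SymType.Has (S : SymType) (k : SymKind) : Prop := S.sq k ≠ 0

/-! ### Representations of a symmetry type -/

/-- A representation of the symmetry type `S` on `E`: for each symmetry of the type an operator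
which is unitary (`gamma`) or antiunitary (`eta`, `tau`), with the multiplication table of the type.
Each operator is invertible since its square is `± 1`. -/
structure SymRep (S : SymType) (E : Type u) [NormedAddCommGroup E] [InnerProductSpace ℂ E] where
  op : (k : SymKind) → S.Has k → E → E
  map_add : ∀ k h x y, op k h (x + y) = op k h x + op k h y
  map_smul : ∀ k h (c : ℂ) x, op k h (c • x) = k.twist c • op k h x
  norm_map : ∀ k h x, ‖op k h x‖ = ‖x‖
  sq : ∀ k h x, op k h (op k h x) = S.sq k • x
  eta_tau : ∀ he ht hg x, op .eta he (op .tau ht x) = op .gamma hg x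
  tau_eta : ∀ he ht hg x, op .tau ht (op .eta he x) = op .gamma hg x

section Rep

variable {S : SymType} {E : Type u} [NormedAddCommGroup E] [InnerProductSpace ℂ E]

/-- The subspace `N` is invariant under all symmetries. -/
def SymRep.Invariant (ρ : SymRep S E) (N : Submodule ℂ E) : Prop :=
  ∀ k h, ∀ x ∈ N, ρ.op k h x ∈ N

/-- The representation on an invariant subspace. -/
def SymRep.restrict (ρ : SymRep S E) (N : Submodule ℂ E) (hN : ρ.Invariant N) : SymRep S N where
  op k h x := ⟨ρ.op k h x, hN k h x x.2⟩
  map_add k h x y := Subtype.ext (ρ.map_add k h x y)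
  map_smul k h c x := Subtype.ext (ρ.map_smul k h c x)
  norm_map k h x := ρ.norm_map k h x
  sq k h x := Subtype.ext (ρ.sq k h x)
  eta_tau he ht hg x := Subtype.ext (ρ.eta_tau he ht hg x)
  tau_eta he ht hg x := Subtype.ext (ρ.tau_eta he ht hg x)

/-- The direct sum of two representations, on the Hilbert space direct sum. -/
def SymRep.sum {F : Type u} [NormedAddCommGroup F] [InnerProductSpace ℂ F]
    (ρ : SymRep S E) (π : SymRep S F) : SymRep S (WithLp 2 (E × F)) where
  op k h x := WithLp.toLp 2 (ρ.op k h x.fst, π.op k h x.snd)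
  map_add k h x y := WithLp.ofLp_injective 2
    (Prod.ext (ρ.map_add k h x.fst y.fst) (π.map_add k h x.snd y.snd))
  map_smul k h c x := WithLp.ofLp_injective 2
    (Prod.ext (ρ.map_smul k h c x.fst) (π.map_smul k h c x.snd))
  norm_map k h x := by
    simp [WithLp.prod_norm_eq_of_L2, ρ.norm_map, π.norm_map]
  sq k h x := WithLp.ofLp_injective 2 (Prod.ext (ρ.sq k h x.fst) (π.sq k h x.snd))
  eta_tau he ht hg x := WithLp.ofLp_injective 2
    (Prod.ext (ρ.eta_tau he ht hg x.fst) (π.eta_tau he ht hg x.snd))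
  tau_eta he ht hg x := WithLp.ofLp_injective 2
    (Prod.ext (ρ.tau_eta he ht hg x.fst) (π.tau_eta he ht hg x.snd))

/-- What a symmetry does to an operator `W`: `η W η⁻¹ = W`, `τ W τ⁻¹ = W⋆`, `γ W γ⁻¹ = W⋆`. -/
def SymKind.image [CompleteSpace E] : SymKind → (E →L[ℂ] E) → (E →L[ℂ] E)
  | .eta, W => W
  | .tau, W => W.adjoint
  | .gamma, W => W.adjoint

/-- `W` satisfies all symmetries of the representation: `σ W = W σ` for `σ = η` and
`σ W = W⋆ σ` for `σ = τ, γ`. -/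
def SymRep.Symmetric [CompleteSpace E] (ρ : SymRep S E) (W : E →L[ℂ] E) : Prop :=
  ∀ k h x, ρ.op k h (W x) = k.image W (ρ.op k h x)

end Rep

/-- `W` is (strictly) gapped: `1` and `-1` lie in the resolvent set. -/
def Gapped {E : Type u} [NormedAddCommGroup E] [InnerProductSpace ℂ E] (W : E →L[ℂ] E) : Prop :=
  (1 : ℂ) ∉ spectrum ℂ W ∧ (-1 : ℂ) ∉ spectrum ℂ W

/-! ### The index group -/

/-- A finite dimensional representation of the symmetry type `S`. -/
structure FinRep (S : SymType) : Type (u + 1) where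
  carrier : Type u
  [normed : NormedAddCommGroup carrier]
  [inner : InnerProductSpace ℂ carrier]
  [findim : FiniteDimensional ℂ carrier]
  rep : SymRep S carrier

attribute [instance] FinRep.normed FinRep.inner FinRep.findim

instance {S : SymType} (F : FinRep.{u} S) : CompleteSpace F.carrier :=
  FiniteDimensional.complete ℂ F.carrier

/-- Direct sum of finite dimensional representations. -/
def FinRep.sum {S : SymType} (F G : FinRep.{u} S) : FinRep.{u} S where
  carrier := WithLp 2 (F.carrier × G.carrier)
  findim := inferInstance
  rep := F.rep.sum G.rep

/-- Unitary equivalence of representations. -/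
def FinRep.Equivalent {S : SymType} (F G : FinRep.{u} S) : Prop :=
  ∃ U : F.carrier ≃ₗᵢ[ℂ] G.carrier, ∀ k h x, U (F.rep.op k h x) = G.rep.op k h (U x)

/-- A representation is balanced if it carries a gapped unitary that satisfies the symmetries. -/
def FinRep.Balanced {S : SymType} (F : FinRep.{u} S) : Prop :=
  ∃ U : F.carrier →L[ℂ] F.carrier,
    U ∈ unitary (F.carrier →L[ℂ] F.carrier) ∧ F.rep.Symmetric U ∧ Gapped U

/-- The relations of the index group: equivalent representations have the same class, direct sums
go to sums, balanced representations go to zero. -/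
def indexRelations (S : SymType) : Set (FreeAbelianGroup (FinRep.{u} S)) :=
  {z | ∃ F G : FinRep.{u} S, F.Equivalent G ∧
      z = FreeAbelianGroup.of F - FreeAbelianGroup.of G} ∪
  {z | ∃ F G : FinRep.{u} S, z = FreeAbelianGroup.of (F.sum G) -
      (FreeAbelianGroup.of F + FreeAbelianGroup.of G)} ∪
  {z | ∃ F : FinRep.{u} S, F.Balanced ∧ z = FreeAbelianGroup.of F}

/-- The index group of a symmetry type: finite dimensional representations modulo balanced ones,
with direct sum as addition. It is given as the universal abelian group with these properties. -/
abbrev IndexGroup (S : SymType) : Type (u + 1) :=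
  FreeAbelianGroup (FinRep.{u} S) ⧸ AddSubgroup.closure (indexRelations.{u} S)

/-- The symmetry index of a finite dimensional representation. -/
def FinRep.index {S : SymType} (F : FinRep.{u} S) : IndexGroup.{u} S :=
  QuotientAddGroup.mk (FreeAbelianGroup.of F)

/-! ### Numerical value of the index -/

/-- The concrete groups in which the indices of the ten types take their values. For `DIII` only
the subgroup `{0, 2}` of `ZMod 4` is attained, for `CII` only the even integers. -/
def IndexValue : SymType → Type
  | .D => ZMod 2
  | .DIII => ZMod 4
  | .AIII => ℤ
  | .BDI => ℤ
  | .CII => ℤ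
  | .A => Unit
  | .C => Unit
  | .AI => Unit
  | .AII => Unit
  | .CI => Unit

instance (S : SymType) : AddCommGroup (IndexValue S) :=
  match S with
  | .D => inferInstanceAs (AddCommGroup (ZMod 2))
  | .DIII => inferInstanceAs (AddCommGroup (ZMod 4))
  | .AIII => inferInstanceAs (AddCommGroup ℤ)
  | .BDI => inferInstanceAs (AddCommGroup ℤ)
  | .CII => inferInstanceAs (AddCommGroup ℤ)
  | .A => inferInstanceAs (AddCommGroup Unit)
  | .C => inferInstanceAs (AddCommGroup Unit)
  | .AI => inferInstanceAs (AddCommGroup Unit)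
  | .AII => inferInstanceAs (AddCommGroup Unit)
  | .CI => inferInstanceAs (AddCommGroup Unit)

/-- The absolute value of an index: the usual one on the integers, the least absolute residue
on `ZMod 2` and `ZMod 4`. -/
def IndexValue.abs : (S : SymType) → IndexValue S → ℕ
  | .D, v => (show ZMod 2 from v).valMinAbs.natAbs
  | .DIII, v => (show ZMod 4 from v).valMinAbs.natAbs
  | .AIII, v => (show ℤ from v).natAbs
  | .BDI, v => (show ℤ from v).natAbs
  | .CII, v => (show ℤ from v).natAbs
  | .A, _ => 0
  | .C, _ => 0
  | .AI, _ => 0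
  | .AII, _ => 0
  | .CI, _ => 0

section Chiral

variable {S : SymType} {E : Type u} [NormedAddCommGroup E] [InnerProductSpace ℂ E]

/-- The chiral symmetry as a linear map. -/
def SymRep.chi (ρ : SymRep S E) (h : S.Has .gamma) : E →ₗ[ℂ] E where
  toFun := ρ.op .gamma h
  map_add' := ρ.map_add .gamma h
  map_smul' c x := ρ.map_smul .gamma h c x

/-- Difference of the multiplicities of the eigenvalues `1` and `-1` of the chiral symmetry; this
is its trace when its square is `1`. -/
def SymRep.chiralTrace (ρ : SymRep S E) (h : S.Has .gamma) : ℤ :=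
  (Module.finrank ℂ (Module.End.eigenspace (ρ.chi h) 1) : ℤ) -
    (Module.finrank ℂ (Module.End.eigenspace (ρ.chi h) (-1)) : ℤ)

end Chiral

/-- The explicit index of a finite dimensional representation: the dimension mod `2` for type `D`
and mod `4` for type `DIII`, the trace of the chiral symmetry for `AIII`, `BDI`, `CII`, and zero
for the remaining types. -/
def FinRep.value : (S : SymType) → FinRep.{u} S → IndexValue S
  | .D, F => ((Module.finrank ℂ F.carrier : ℕ) : ZMod 2)
  | .DIII, F => ((Module.finrank ℂ F.carrier : ℕ) : ZMod 4)
  | .AIII, F => F.rep.chiralTrace (show (1 : ℤ) ≠ 0 from one_ne_zero)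
  | .BDI, F => F.rep.chiralTrace (show (1 : ℤ) ≠ 0 from one_ne_zero)
  | .CII, F => F.rep.chiralTrace (show (1 : ℤ) ≠ 0 from one_ne_zero)
  | .A, _ => ()
  | .C, _ => ()
  | .AI, _ => ()
  | .AII, _ => ()
  | .CI, _ => ()

end QWalk

namespace QWalk

/-! ### The explicit index is a homomorphism on the index group -/

section Eigen

variable {V W : Type*} [AddCommGroup V] [Module ℂ V] [AddCommGroup W] [Module ℂ W]

theorem finrank_eigenspace_congr (f : Module.End ℂ V) (g : Module.End ℂ W) (e : V ≃ₗ[ℂ] W)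
    (h : ∀ x, e (f x) = g (e x)) (c : ℂ) :
    Module.finrank ℂ (Module.End.eigenspace f c) = Module.finrank ℂ (Module.End.eigenspace g c) := by
  have hm : (Module.End.eigenspace f c).map (e : V →ₗ[ℂ] W) = Module.End.eigenspace g c := by
    ext y
    simp only [Submodule.mem_map, Module.End.mem_eigenspace_iff]
    constructor
    · rintro ⟨x, hx, rfl⟩
      simp [← h, hx]
    · intro hy
      refine ⟨e.symm y, e.injective ?_, by simp⟩
      simp [h, hy]
  rw [← hm]
  exact (e.submoduleMap _).finrank_eq

theorem finrank_eigenspace_prodMap [FiniteDimensional ℂ V] [FiniteDimensional ℂ W]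
    (f : Module.End ℂ V) (g : Module.End ℂ W) (c : ℂ) :
    Module.finrank ℂ (Module.End.eigenspace (f.prodMap g : Module.End ℂ (V × W)) c) =
      Module.finrank ℂ (Module.End.eigenspace f c) +
        Module.finrank ℂ (Module.End.eigenspace g c) := by
  have hm : Module.End.eigenspace (f.prodMap g : Module.End ℂ (V × W)) c =
      (Module.End.eigenspace f c).prod (Module.End.eigenspace g c) := by
    ext ⟨x, y⟩
    simp [Prod.ext_iff]
  rw [hm, ← Module.finrank_prod]
  exact LinearEquiv.finrank_eq
    { toFun := fun x => (⟨x.1.1, x.2.1⟩, ⟨x.1.2, x.2.2⟩)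
      invFun := fun x => ⟨(x.1.1, x.2.1), x.1.2, x.2.2⟩
      map_add' := fun _ _ => rfl
      map_smul' := fun _ _ => rfl
      left_inv := fun _ => rfl
      right_inv := fun _ => rfl }

/-- A finite dimensional space with a nondegenerate antisymmetric bilinear form has even
dimension. -/
theorem even_finrank_of_antisymm [FiniteDimensional ℂ V] (B : V → V → ℂ)
    (add_left : ∀ x y z, B (x + y) z = B x z + B y z)
    (smul_left : ∀ (c : ℂ) x z, B (c • x) z = c * B x z)
    (antisymm : ∀ x y, B x y = - B y x)
    (nondeg : ∀ y, (∀ x, B x y = 0) → y = 0) :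
    Even (Module.finrank ℂ V) := by
  let b := Module.finBasis ℂ V
  let Bl : V →ₗ[ℂ] V →ₗ[ℂ] ℂ := LinearMap.mk₂ ℂ B add_left smul_left
    (fun x y z => by rw [antisymm, add_left, neg_add, ← antisymm, ← antisymm])
    (fun c x y => by rw [antisymm, smul_left, ← mul_neg, ← antisymm]; rfl)
  let M : Matrix (Fin (Module.finrank ℂ V)) (Fin (Module.finrank ℂ V)) ℂ :=
    Matrix.of fun i j => B (b i) (b j)
  have hM : M.transpose = -M := by
    ext i j
    simp only [M, Matrix.transpose_apply, Matrix.of_apply, Matrix.neg_apply]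
    exact antisymm _ _
  have hdet : M.det ≠ 0 := by
    intro h0
    obtain ⟨v, hv, hv0⟩ := Matrix.exists_mulVec_eq_zero_iff.2 h0
    apply hv
    have hy : (∑ j, v j • b j) = 0 := by
      apply nondeg
      intro x
      change Bl x _ = 0
      have key : (Bl.flip (∑ j, v j • b j)) = 0 := by
        apply b.ext
        intro i
        have := congrFun hv0 i
        simp only [Matrix.mulVec, dotProduct, M, Matrix.of_apply, Pi.zero_apply] at this
        have h2 : Bl.flip (∑ j, v j • b j) (b i) = ∑ j, v j * B (b i) (b j) := by
          rw [LinearMap.flip_apply, map_sum]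
          exact Finset.sum_congr rfl fun j _ => by rw [map_smul, smul_eq_mul]; rfl
        rw [h2, LinearMap.zero_apply, ← this]
        exact Finset.sum_congr rfl fun j _ => mul_comm _ _
      have := congrArg (fun f => f x) key
      simpa using this
    have := (Fintype.linearIndependent_iff.1 b.linearIndependent) v hy
    exact funext this
  have h1 : M.det = (-1) ^ (Module.finrank ℂ V) * M.det := by
    conv_lhs => rw [← Matrix.det_transpose, hM, Matrix.det_neg, Fintype.card_fin]
  by_contra hodd
  rw [Nat.not_even_iff_odd] at hodd
  rw [hodd.neg_one_pow] at h1
  apply hdet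
  linear_combination h1 / 2

end Eigen

section Value

variable {S : SymType} {E : Type u} [NormedAddCommGroup E] [InnerProductSpace ℂ E]

theorem SymRep.op_zero (ρ : SymRep S E) (k h) : ρ.op k h 0 = 0 := by
  have := ρ.norm_map k h 0
  simpa using this

theorem SymRep.op_neg (ρ : SymRep S E) (k h) (x : E) : ρ.op k h (-x) = - ρ.op k h x := by
  have := ρ.map_add k h x (-x)
  rw [add_neg_cancel, ρ.op_zero] at this
  exact (neg_eq_of_add_eq_zero_right this.symm).symm

theorem SymRep.op_sub (ρ : SymRep S E) (k h) (x y : E) :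
    ρ.op k h (x - y) = ρ.op k h x - ρ.op k h y := by
  rw [sub_eq_add_neg, ρ.map_add, ρ.op_neg, ← sub_eq_add_neg]

/-- An antiunitary operator conjugates inner products. -/
theorem SymRep.inner_op (ρ : SymRep S E) (k h) (hk : k.twist = starRingEnd ℂ) (x y : E) :
    ⟪ρ.op k h x, ρ.op k h y⟫_ℂ = ⟪y, x⟫_ℂ := by
  have hI : ρ.op k h (Complex.I • y) = -(Complex.I • ρ.op k h y) := by
    rw [ρ.map_smul, hk]; simp
  have hI' : ρ.op k h (Complex.I • x) = -(Complex.I • ρ.op k h x) := by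
    rw [ρ.map_smul, hk]; simp
  rw [inner_eq_sum_norm_sq_div_four (ρ.op k h x) (ρ.op k h y), inner_eq_sum_norm_sq_div_four y x]
  simp only [RCLike.I_to_complex]
  have e1 : ‖ρ.op k h x + ρ.op k h y‖ = ‖y + x‖ := by
    rw [← ρ.map_add, ρ.norm_map, add_comm]
  have e2 : ‖ρ.op k h x - ρ.op k h y‖ = ‖y - x‖ := by
    rw [← ρ.op_sub, ρ.norm_map, norm_sub_rev]
  have e3 : ‖ρ.op k h x - Complex.I • ρ.op k h y‖ = ‖y - Complex.I • x‖ := by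
    have : ρ.op k h x - Complex.I • ρ.op k h y = ρ.op k h (x + Complex.I • y) := by
      rw [ρ.map_add, hI, sub_eq_add_neg]
    rw [this, ρ.norm_map]
    have : y - Complex.I • x = -(Complex.I • (x + Complex.I • y)) := by
      rw [smul_add, smul_smul, Complex.I_mul_I]; simp
      abel
    rw [this, norm_neg, norm_smul]; simp
  have e4 : ‖ρ.op k h x + Complex.I • ρ.op k h y‖ = ‖y + Complex.I • x‖ := by
    have : ρ.op k h x + Complex.I • ρ.op k h y = ρ.op k h (x - Complex.I • y) := by
      rw [ρ.op_sub, hI, sub_neg_eq_add]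
    rw [this, ρ.norm_map]
    have : y + Complex.I • x = Complex.I • (x - Complex.I • y) := by
      rw [smul_sub, smul_smul, Complex.I_mul_I]; simp
      abel
    rw [this, norm_smul]; simp
  rw [e1, e2, e3, e4]

theorem SymRep.inner_op_left (ρ : SymRep S E) (k h) (hk : k.twist = starRingEnd ℂ) (x y : E) :
    (S.sq k : ℂ) * ⟪ρ.op k h x, y⟫_ℂ = ⟪ρ.op k h y, x⟫_ℂ := by
  have := ρ.inner_op k h hk x (ρ.op k h y)
  rw [ρ.sq, ← Int.cast_smul_eq_zsmul ℂ, inner_smul_right] at this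
  exact this

variable [CompleteSpace E]

/-- For a gapped unitary `U` the operator `U - U⋆` is injective. -/
theorem sub_adjoint_injective (U : E →L[ℂ] E) (hU : U ∈ unitary (E →L[ℂ] E)) (hg : Gapped U)
    (x : E) (hx : U x - U.adjoint x = 0) : x = 0 := by
  have h1 : U (U.adjoint x) = x := by
    have := hU.2
    exact congrArg (fun T : E →L[ℂ] E => T x) this
  have h2 : U (U x) = x := by rw [sub_eq_zero.1 hx, h1]
  have inj : ∀ c : ℂ, c ∉ spectrum ℂ U → ∀ y, U y = c • y → y = 0 := by
    intro c hc y hy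
    rw [spectrum.notMem_iff] at hc
    obtain ⟨R, hR⟩ := hc.exists_left_inv
    have := congrArg (fun T : E →L[ℂ] E => T y) hR
    simp [hy, Algebra.algebraMap_eq_smul_one] at this
    exact this.symm
  have h3 : U x + x = 0 := by
    apply inj 1 hg.1
    rw [map_add, h2, one_smul, add_comm]
  apply inj (-1) hg.2
  rw [neg_one_smul]
  exact eq_neg_of_add_eq_zero_left h3


/-- The operator `U - U⋆` is skew-adjoint. -/
theorem inner_sub_adjoint (U : E →L[ℂ] E) (x y : E) :
    ⟪x, U y - U.adjoint y⟫_ℂ = - ⟪U x - U.adjoint x, y⟫_ℂ := by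
  rw [inner_sub_right, inner_sub_left, ContinuousLinearMap.adjoint_inner_right,
    ← ContinuousLinearMap.adjoint_inner_left]
  ring

theorem SymRep.op_sub_adjoint (ρ : SymRep S E) (U : E →L[ℂ] E)
    (hU : U ∈ unitary (E →L[ℂ] E)) (hs : ρ.Symmetric U) (x : E) :
    (∀ h, ρ.op .eta h (U x - U.adjoint x) =
      U (ρ.op .eta h x) - U.adjoint (ρ.op .eta h x)) ∧
    (∀ h, ρ.op .tau h (U x - U.adjoint x) =
      -(U (ρ.op .tau h x) - U.adjoint (ρ.op .tau h x))) ∧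
    (∀ h, ρ.op .gamma h (U x - U.adjoint x) =
      -(U (ρ.op .gamma h x) - U.adjoint (ρ.op .gamma h x))) := by
  have h1 : ∀ y, U (U.adjoint y) = y := fun y =>
    congrArg (fun T : E →L[ℂ] E => T y) hU.2
  have h2 : ∀ y, U.adjoint (U y) = y := fun y =>
    congrArg (fun T : E →L[ℂ] E => T y) hU.1
  refine ⟨fun h => ?_, fun h => ?_, fun h => ?_⟩
  · have ha := hs .eta h x
    have hb := hs .eta h (U.adjoint x)
    simp only [SymKind.image, h1] at ha hb
    rw [ρ.op_sub, ha, hb, h2]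
  · have ha := hs .tau h x
    have hb := hs .tau h (U.adjoint x)
    simp only [SymKind.image, h1] at ha hb
    rw [ρ.op_sub, ha, hb, h1]
    abel
  · have ha := hs .gamma h x
    have hb := hs .gamma h (U.adjoint x)
    simp only [SymKind.image, h1] at ha hb
    rw [ρ.op_sub, ha, hb, h1]
    abel

/-- If the chiral symmetry `γ` anticommutes with an injective operator, all its eigenspaces for
`c` and `-c` have equal dimension. -/
theorem finrank_eigenspace_neg {V : Type*} [AddCommGroup V] [Module ℂ V] [FiniteDimensional ℂ V]
    (f T : Module.End ℂ V) (hT : ∀ x, T x = 0 → x = 0) (h : ∀ x, f (T x) = -T (f x)) (c : ℂ) :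
    Module.finrank ℂ (Module.End.eigenspace f c) =
      Module.finrank ℂ (Module.End.eigenspace f (-c)) := by
  have main : ∀ c : ℂ, Module.finrank ℂ (Module.End.eigenspace f c) ≤
      Module.finrank ℂ (Module.End.eigenspace f (-c)) := by
    intro c
    have hmap : ∀ x ∈ Module.End.eigenspace f c, T x ∈ Module.End.eigenspace f (-c) := by
      intro x hx
      rw [Module.End.mem_eigenspace_iff] at hx ⊢
      rw [h, hx, map_smul, neg_smul]
    refine LinearMap.finrank_le_finrank_of_injective (f := T.restrict hmap) ?_
    rw [← LinearMap.ker_eq_bot, LinearMap.ker_eq_bot']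
    intro x hx
    exact Subtype.ext (hT x (congrArg Subtype.val hx))
  refine le_antisymm (main c) ?_
  have := main (-c)
  rwa [neg_neg] at this

theorem finrank_eq_eigenspaces {V : Type*} [AddCommGroup V] [Module ℂ V] [FiniteDimensional ℂ V]
    (f : Module.End ℂ V) (hf : ∀ x, f (f x) = -x) :
    Module.finrank ℂ (Module.End.eigenspace f Complex.I) +
      Module.finrank ℂ (Module.End.eigenspace f (-Complex.I)) = Module.finrank ℂ V := by
  apply Submodule.finrank_add_eq_of_isCompl
  constructor
  · rw [Submodule.disjoint_def]
    intro x h1 h2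
    rw [Module.End.mem_eigenspace_iff] at h1 h2
    have h3 : (2 * Complex.I) • x = 0 := by
      rw [two_mul, add_smul]
      nth_rewrite 1 [← h1]
      rw [h2, neg_smul, neg_add_cancel]
    simpa using h3
  · rw [codisjoint_iff, eq_top_iff]
    intro x _
    have hx : x = (1 / 2 : ℂ) • (x - Complex.I • f x) + (1 / 2 : ℂ) • (x + Complex.I • f x) := by
      module
    rw [hx]
    refine Submodule.add_mem_sup (Submodule.smul_mem _ _ ?_) (Submodule.smul_mem _ _ ?_)
    · rw [Module.End.mem_eigenspace_iff, map_sub, map_smul, hf, smul_sub, smul_smul,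
        Complex.I_mul_I]
      module
    · rw [Module.End.mem_eigenspace_iff, map_add, map_smul, hf, smul_add, smul_smul,
        neg_mul, Complex.I_mul_I]
      module

end Value

theorem SymRep.chiralTrace_balanced {S : SymType} (F : FinRep.{u} S) (hF : F.Balanced)
    (h : S.Has .gamma) : F.rep.chiralTrace h = 0 := by
  obtain ⟨U, hU, hs, hg⟩ := hF
  rw [SymRep.chiralTrace, sub_eq_zero, Nat.cast_inj]
  refine finrank_eigenspace_neg (F.rep.chi h) ((U - U.adjoint : F.carrier →L[ℂ] F.carrier))
    (fun x hx => sub_adjoint_injective U hU hg x hx) ?_ 1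
  intro x
  exact (F.rep.op_sub_adjoint U hU hs x).2.2 h

theorem FinRep.value_balanced {S : SymType} (F : FinRep.{u} S) (hF : F.Balanced) :
    F.value S = 0 := by
  cases S with
  | A => rfl
  | C => rfl
  | AI => rfl
  | AII => rfl
  | CI => rfl
  | AIII => exact SymRep.chiralTrace_balanced F hF _
  | BDI => exact SymRep.chiralTrace_balanced F hF _
  | CII => exact SymRep.chiralTrace_balanced F hF _
  | D =>
    obtain ⟨U, hU, hs, hg⟩ := hF
    have he : SymType.D.Has .eta := show (1 : ℤ) ≠ 0 from one_ne_zero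
    have hsw := F.rep.inner_op_left .eta he rfl
    simp only [SymType.sq, Int.cast_one, one_mul] at hsw
    have hev : Even (Module.finrank ℂ F.carrier) := by
      refine even_finrank_of_antisymm
        (fun x y => ⟪F.rep.op .eta he x, U y - U.adjoint y⟫_ℂ) ?_ ?_ ?_ ?_
      · intro x y z
        rw [F.rep.map_add, inner_add_left]
      · intro c x z
        rw [F.rep.map_smul, inner_smul_left, SymKind.twist, Complex.conj_conj]
      · intro x y
        rw [inner_sub_adjoint, ← (F.rep.op_sub_adjoint U hU hs x).1, hsw]
      · intro y hy
        have := hy (F.rep.op .eta he (U y - U.adjoint y))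
        rw [F.rep.sq] at this
        simp only [SymType.sq, one_smul] at this
        exact sub_adjoint_injective U hU hg y (inner_self_eq_zero.1 this)
    exact (ZMod.natCast_eq_zero_iff _ 2).2 hev.two_dvd
  | DIII =>
    obtain ⟨U, hU, hs, hg⟩ := hF
    have ht : SymType.DIII.Has .tau := show (-1 : ℤ) ≠ 0 by decide
    have he : SymType.DIII.Has .eta := show (1 : ℤ) ≠ 0 by decide
    have hc : SymType.DIII.Has .gamma := show (-1 : ℤ) ≠ 0 by decide
    have hsw := F.rep.inner_op_left .tau ht rfl
    have hsq : ∀ x, F.rep.chi hc (F.rep.chi hc x) = -x := by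
      intro x
      have := F.rep.sq .gamma hc x
      simp only [SymType.sq, neg_smul, one_smul] at this
      exact this
    have hcT : ∀ x, F.rep.chi hc (U x - U.adjoint x) =
        -(U (F.rep.chi hc x) - U.adjoint (F.rep.chi hc x)) := fun x =>
      (F.rep.op_sub_adjoint U hU hs x).2.2 hc
    have hcomm : ∀ x, F.rep.chi hc (F.rep.op .tau ht x) = F.rep.op .tau ht (F.rep.chi hc x) := by
      intro x
      change F.rep.op .gamma hc _ = F.rep.op .tau ht (F.rep.op .gamma hc x)
      rw [← F.rep.tau_eta he ht hc, F.rep.eta_tau he ht hc]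

    have hdim := finrank_eq_eigenspaces (F.rep.chi hc) hsq
    have heq := finrank_eigenspace_neg (F.rep.chi hc)
      ((U - U.adjoint : F.carrier →L[ℂ] F.carrier))
      (fun x hx => sub_adjoint_injective U hU hg x hx) hcT Complex.I
    have hev : Even (Module.finrank ℂ (Module.End.eigenspace (F.rep.chi hc) Complex.I)) := by
      refine even_finrank_of_antisymm
        (fun x y => ⟪F.rep.op .tau ht x, U (y : F.carrier) - U.adjoint (y : F.carrier)⟫_ℂ)
        ?_ ?_ ?_ ?_
      · intro x y z
        rw [Submodule.coe_add, F.rep.map_add, inner_add_left]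
      · intro c x z
        rw [Submodule.coe_smul, F.rep.map_smul, inner_smul_left, SymKind.twist,
          Complex.conj_conj]
      · intro x y
        have h1 := hsw (U (x : F.carrier) - U.adjoint (x : F.carrier)) y
        rw [(F.rep.op_sub_adjoint U hU hs x).2.1] at h1
        simp only [SymType.sq, inner_neg_left] at h1
        rw [inner_sub_adjoint, ← h1]
        push_cast
        ring
      · intro y hy
        have hmem : F.rep.op .tau ht (U (y : F.carrier) - U.adjoint (y : F.carrier)) ∈
            Module.End.eigenspace (F.rep.chi hc) Complex.I := by
          rw [Module.End.mem_eigenspace_iff, hcomm, hcT, Module.End.mem_eigenspace_iff.1 y.2,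
            map_smul, map_smul, ← smul_sub, ← neg_smul, F.rep.map_smul]
          simp [SymKind.twist]
        have := hy ⟨_, hmem⟩
        simp only [F.rep.sq] at this
        simp only [SymType.sq, neg_smul, one_smul, inner_neg_left, neg_eq_zero] at this
        exact Subtype.ext (sub_adjoint_injective U hU hg y (inner_self_eq_zero.1 this))
    refine (ZMod.natCast_eq_zero_iff _ 4).2 ?_
    obtain ⟨m, hm⟩ := hev
    omega

theorem FinRep.value_equivalent {S : SymType} (F G : FinRep.{u} S) (h : F.Equivalent G) :
    F.value S = G.value S := by
  obtain ⟨U, hU⟩ := h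
  have hd : Module.finrank ℂ F.carrier = Module.finrank ℂ G.carrier :=
    U.toLinearEquiv.finrank_eq
  have hc : ∀ hg, F.rep.chiralTrace hg = G.rep.chiralTrace hg := by
    intro hg
    have := finrank_eigenspace_congr (F.rep.chi hg) (G.rep.chi hg) U.toLinearEquiv
      (fun x => hU .gamma hg x)
    rw [SymRep.chiralTrace, SymRep.chiralTrace, this, this]
  cases S with
  | A => rfl
  | C => rfl
  | AI => rfl
  | AII => rfl
  | CI => rfl
  | AIII => exact hc _
  | BDI => exact hc _
  | CII => exact hc _
  | D => exact congrArg (Nat.cast : ℕ → ZMod 2) hd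
  | DIII => exact congrArg (Nat.cast : ℕ → ZMod 4) hd

theorem FinRep.value_sum {S : SymType} (F G : FinRep.{u} S) :
    (F.sum G).value S = F.value S + G.value S := by
  have hd : Module.finrank ℂ (F.sum G).carrier =
      Module.finrank ℂ F.carrier + Module.finrank ℂ G.carrier := by
    rw [← Module.finrank_prod]
    exact (WithLp.linearEquiv 2 ℂ (F.carrier × G.carrier)).finrank_eq
  have hc : ∀ hg, (F.sum G).rep.chiralTrace hg =
      F.rep.chiralTrace hg + G.rep.chiralTrace hg := by
    intro hg
    have := finrank_eigenspace_congr ((F.sum G).rep.chi hg)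
      ((F.rep.chi hg).prodMap (G.rep.chi hg))
      (WithLp.linearEquiv 2 ℂ (F.carrier × G.carrier)) (fun x => rfl)
    rw [SymRep.chiralTrace, SymRep.chiralTrace, SymRep.chiralTrace, this, this,
      finrank_eigenspace_prodMap, finrank_eigenspace_prodMap]
    push_cast
    ring
  cases S with
  | A => rfl
  | C => rfl
  | AI => rfl
  | AII => rfl
  | CI => rfl
  | AIII => exact hc _
  | BDI => exact hc _
  | CII => exact hc _
  | D => exact (congrArg (Nat.cast : ℕ → ZMod 2) hd).trans (Nat.cast_add _ _)
  | DIII => exact (congrArg (Nat.cast : ℕ → ZMod 4) hd).trans (Nat.cast_add _ _)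

/-- The explicit index as a homomorphism on the index group. -/
def indexValue (S : SymType) : IndexGroup.{u} S →+ IndexValue S :=
  QuotientAddGroup.lift _ (FreeAbelianGroup.lift (FinRep.value S)) (by
    rw [AddSubgroup.closure_le]
    rintro z ((⟨F, G, h, rfl⟩ | ⟨F, G, rfl⟩) | ⟨F, h, rfl⟩)
    · simp [F.value_equivalent G h]
    · simp [F.value_sum G]
    · simp [F.value_balanced h])

theorem indexValue_index {S : SymType} (F : FinRep.{u} S) :
    indexValue S F.index = F.value S := by
  simp [indexValue, FinRep.index]

/-- The absolute value of an index, computed in the concrete groups. -/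
def indexAbs {S : SymType} (j : IndexGroup.{u} S) : ℕ := IndexValue.abs S (indexValue S j)

/-! ### Operators on a Hilbert space with symmetries -/

section Operators

variable {S : SymType} {H : Type u} [NormedAddCommGroup H] [InnerProductSpace ℂ H]

/-- The symmetries act on the subspace `N`, which is finite dimensional. -/
def SymRep.HasIndexOn (ρ : SymRep S H) (N : Submodule ℂ H) : Prop :=
  FiniteDimensional ℂ N ∧ ρ.Invariant N

open Classical in
/-- The symmetry index of the representation on a finite dimensional invariant subspace `N`
(with value `0` if `N` is not of this kind). -/
def SymRep.indexOn (ρ : SymRep S H) (N : Submodule ℂ H) : IndexGroup.{u} S :=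
  if h : ρ.HasIndexOn N then
    haveI := h.1
    (FinRep.mk N (ρ.restrict N h.2)).index
  else 0

/-- The eigenspace of an operator. -/
abbrev eigenspace (W : H →L[ℂ] H) (c : ℂ) : Submodule ℂ H :=
  Module.End.eigenspace (W : H →ₗ[ℂ] H) c

/-- The index of an admissible unitary: the sum of the symmetry indices of its eigenspaces at
`1` and `-1`. -/
def SymRep.si (ρ : SymRep S H) (W : H →L[ℂ] H) : IndexGroup.{u} S :=
  ρ.indexOn (eigenspace W 1) + ρ.indexOn (eigenspace W (-1))

/-- `W - c` is invertible modulo compact operators, i.e. `c` is not in the spectrum of the image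
of `W` in the Calkin algebra. -/
def EssResolvent (W : H →L[ℂ] H) (c : ℂ) : Prop :=
  ∃ R : H →L[ℂ] H, IsCompactOperator (R ∘L (W - c • ContinuousLinearMap.id ℂ H) -
      ContinuousLinearMap.id ℂ H) ∧
    IsCompactOperator ((W - c • ContinuousLinearMap.id ℂ H) ∘L R - ContinuousLinearMap.id ℂ H)

/-- `W` is essentially gapped: `1` and `-1` are not in its essential spectrum. -/
def EssGapped (W : H →L[ℂ] H) : Prop := EssResolvent W 1 ∧ EssResolvent W (-1)

variable [CompleteSpace H]

/-- Admissible unitaries: they satisfy the symmetries and are essentially gapped. -/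
structure SymRep.Admissible (ρ : SymRep S H) (W : H →L[ℂ] H) : Prop where
  unitary : W ∈ unitary (H →L[ℂ] H)
  symmetric : ρ.Symmetric W
  essGapped : EssGapped W

/-- The imaginary part `(W - W⋆) / 2i`. -/
def imPart (W : H →L[ℂ] H) : H →L[ℂ] H := (1 / (2 * Complex.I)) • (W - W.adjoint)

/-- For a closed subspace `K` with projection `P`, the kernel, within `K`, of the imaginary part
of `P W P`. -/
def imKernel (K : Submodule ℂ H) [K.HasOrthogonalProjection] (W : H →L[ℂ] H) : Submodule ℂ H :=
  K ⊓ eigenspace (imPart (K.starProjection ∘L W ∘L K.starProjection)) 0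

/-- The index of `P W P` as an (essentially unitary) operator on the closed subspace `K = P H`:
the symmetry index of the `0`-eigenspace of its imaginary part. -/
def SymRep.siCompression (ρ : SymRep S H) (K : Submodule ℂ H) [K.HasOrthogonalProjection]
    (W : H →L[ℂ] H) : IndexGroup.{u} S :=
  ρ.indexOn (imKernel K W)

end Operators

/-! ### Cell structure, walks and half-line indices -/

/-- A decomposition of a Hilbert space into an orthogonal direct sum of finite dimensional,
nonzero cells, indexed by the integers. -/
structure CellStructure (H : Type u) [NormedAddCommGroup H] [InnerProductSpace ℂ H] where
  cell : ℤ → Submodule ℂ H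
  finiteDimensional : ∀ x, FiniteDimensional ℂ (cell x)
  ne_bot : ∀ x, cell x ≠ ⊥
  orthogonal : Pairwise fun x y => cell x ⟂ cell y
  dense : (⨆ x, cell x).topologicalClosure = ⊤

namespace CellStructure

variable {S : SymType} {H : Type u} [NormedAddCommGroup H] [InnerProductSpace ℂ H]

/-- The symmetries act locally: they leave every cell invariant. -/
def LocalSymmetry (𝓒 : CellStructure H) (ρ : SymRep S H) : Prop :=
  ∀ x, ρ.Invariant (𝓒.cell x)

/-- The representation in the cell at `x`. -/
def cellRep (𝓒 : CellStructure H) (ρ : SymRep S H) (h : 𝓒.LocalSymmetry ρ) (x : ℤ) :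
    FinRep.{u} S :=
  haveI := 𝓒.finiteDimensional x
  FinRep.mk (𝓒.cell x) (ρ.restrict (𝓒.cell x) (h x))

/-- The symmetries act locally, and in a balanced way in each cell. -/
def BalancedSymmetry (𝓒 : CellStructure H) (ρ : SymRep S H) : Prop :=
  ∃ h : 𝓒.LocalSymmetry ρ, ∀ x, (𝓒.cellRep ρ h x).Balanced

/-- The closed span of the cells at `x ≥ a`. -/
def right (𝓒 : CellStructure H) (a : ℤ) : Submodule ℂ H :=
  (⨆ x : {x : ℤ // a ≤ x}, 𝓒.cell x).topologicalClosure

/-- The closed span of the cells at `x < a`. -/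
def left (𝓒 : CellStructure H) (a : ℤ) : Submodule ℂ H :=
  (⨆ x : {x : ℤ // x < a}, 𝓒.cell x).topologicalClosure

variable [CompleteSpace H]

instance (𝓒 : CellStructure H) (a : ℤ) : CompleteSpace (𝓒.right a) :=
  inferInstanceAs (CompleteSpace (Submodule.topologicalClosure _))

instance (𝓒 : CellStructure H) (a : ℤ) : CompleteSpace (𝓒.left a) :=
  inferInstanceAs (CompleteSpace (Submodule.topologicalClosure _))

/-- The projection `P_{≥ a}`. -/
def Pge (𝓒 : CellStructure H) (a : ℤ) : H →L[ℂ] H := (𝓒.right a).starProjection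

/-- The projection `P_{< a}`. -/
def Plt (𝓒 : CellStructure H) (a : ℤ) : H →L[ℂ] H := (𝓒.left a).starProjection

/-- `W` is essentially local: `P_{≥ a} - W⋆ P_{≥ a} W` is compact for some `a`. -/
def EssLocal (𝓒 : CellStructure H) (W : H →L[ℂ] H) : Prop :=
  ∃ a : ℤ, IsCompactOperator (𝓒.Pge a - W.adjoint ∘L 𝓒.Pge a ∘L W)

/-- An admissible walk: an admissible unitary which is essentially local. -/
structure AdmissibleWalk (𝓒 : CellStructure H) (ρ : SymRep S H) (W : H →L[ℂ] H) : Prop where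
  admissible : ρ.Admissible W
  essLocal : 𝓒.EssLocal W

/-- A bulk walk: an admissible walk which is properly gapped. -/
structure BulkWalk (𝓒 : CellStructure H) (ρ : SymRep S H) (W : H →L[ℂ] H) : Prop where
  walk : 𝓒.AdmissibleWalk ρ W
  gapped : Gapped W

/-- The right index `si (P_{≥ a} W P_{≥ a})`, computed at the cut point `a`. -/
def rightIndex (𝓒 : CellStructure H) (ρ : SymRep S H) (a : ℤ) (W : H →L[ℂ] H) :
    IndexGroup.{u} S :=
  ρ.siCompression (𝓒.right a) W

/-- The left index `si (P_{< a} W P_{< a})`, computed at the cut point `a`. -/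
def leftIndex (𝓒 : CellStructure H) (ρ : SymRep S H) (a : ℤ) (W : H →L[ℂ] H) :
    IndexGroup.{u} S :=
  ρ.siCompression (𝓒.left a) W

/-- The left and right indices of `W` are defined at every cut point: the subspaces which carry
the relevant representations are finite dimensional and invariant under the symmetries. -/
def HasHalfIndices (𝓒 : CellStructure H) (ρ : SymRep S H) (W : H →L[ℂ] H) : Prop :=
  ∀ a : ℤ, ρ.HasIndexOn (imKernel (𝓒.left a) W) ∧ ρ.HasIndexOn (imKernel (𝓒.right a) W)

end CellStructure

end QWalk

end

/-! Everything is reduced to the skew-adjoint operator `B = W - W⋆`. Since `W` is unitary, `ker B =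
ker (W - 1) ⊕ ker (W + 1)`; the symmetries commute with `B` up to a fixed sign; and `B = W⋆ (W - 1)
(W + 1)` is invertible modulo compacts when `W` is essentially gapped. So `si W` is the index of
`ker B`, and the half-line indices are indices of kernels of compressions of `B`.

The central fact is `SymRep.SkewCompatible.indexOn_ker_congr`: the index of the kernel does not
change under compact perturbations within the compatible skew-adjoint operators. Along a straight
path the dimension of the kernel may jump. Near any point, however, a Schur complement argument
(`SymRep.SkewCompatible.indexOn_ker_eq`) identifies the new kernel with the radical of a skew form
on a copy of the old kernel, and passing to the radical removes only a balanced piece.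

Essential locality says that `W` commutes modulo compacts with the half-line projections. Hence `B`
is a compact perturbation of its block diagonal part, and `si W` is the sum of a left and a right
index. Moving one cut by one site removes a single cell, whose index is zero by balance, so the cuts
are arbitrary.

For a crossover, unitarity forces the off-diagonal blocks to be compact
(`calkin_off_diagonal_eq_zero`). In the Calkin algebra `W` is therefore `W_R` on the right and `W_L`
on the left, which makes it admissible. Its right index is that of `W_R` and its left index that of
`W_L`; the latter is minus the right index of `W_L`, because a gapped walk has `si = 0`. The
dimension bound holds because the numerical value of an index never exceeds the dimension of a
representation that has it. -/

namespace QWalk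

/-! ### Compact operators, the Calkin algebra and essentially invertible operators. -/

section Compact

variable {H : Type u} [NormedAddCommGroup H] [InnerProductSpace ℂ H]

/-- The ideal of compact operators. -/
def compactIdeal (H : Type u) [NormedAddCommGroup H] [InnerProductSpace ℂ H] :
    TwoSidedIdeal (H →L[ℂ] H) :=
  .mk' {T | IsCompactOperator T} isCompactOperator_zero (fun hx hy => hx.add hy)
    (fun hx => hx.neg) (fun {x _} hy => hy.clm_comp x) (fun {_ y} hx => hx.comp_clm y)

/-- The Calkin algebra, as a ring. -/
abbrev Calkin (H : Type u) [NormedAddCommGroup H] [InnerProductSpace ℂ H] : Type u :=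
  (compactIdeal H).ringCon.Quotient

/-- The quotient map to the Calkin algebra. -/
def calkin : (H →L[ℂ] H) →+* Calkin H := (compactIdeal H).ringCon.mk'

theorem calkin_eq_zero_iff {T : H →L[ℂ] H} : calkin T = 0 ↔ IsCompactOperator T := by
  rw [← TwoSidedIdeal.mem_ker, calkin, TwoSidedIdeal.ker_ringCon_mk']
  exact TwoSidedIdeal.mem_mk' ..

theorem calkin_eq_iff {T T' : H →L[ℂ] H} : calkin T = calkin T' ↔ IsCompactOperator (T - T') := by
  rw [← sub_eq_zero, ← map_sub, calkin_eq_zero_iff]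

theorem calkin_surjective : Function.Surjective (calkin (H := H)) :=
  RingCon.mk'_surjective _

theorem essResolvent_iff {W : H →L[ℂ] H} {c : ℂ} :
    EssResolvent W c ↔ IsUnit (calkin (W - c • ContinuousLinearMap.id ℂ H)) := by
  rw [isUnit_iff_exists]
  constructor
  · rintro ⟨R, h1, h2⟩
    refine ⟨calkin R, ?_, ?_⟩ <;> rw [← map_mul, ← map_one calkin, calkin_eq_iff]
    exacts [h2, h1]
  · rintro ⟨r, h1, h2⟩
    obtain ⟨R, rfl⟩ := calkin_surjective r
    rw [← map_mul, ← map_one calkin, calkin_eq_iff] at h1 h2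
    exact ⟨R, h2, h1⟩

theorem isCompactOperator_of_finiteDimensional (K : Submodule ℂ H) [FiniteDimensional ℂ K]
    (T : H →L[ℂ] H) (hT : ∀ x, T x ∈ K) : IsCompactOperator T := by
  have h : IsCompactOperator (T.codRestrict K hT) := by
    have : ProperSpace K := FiniteDimensional.proper ℂ K
    exact isCompactOperator_of_locallyCompactSpace_dom (T.codRestrict K hT)
  exact h.clm_comp K.subtypeL

/-- If `R B - 1` is compact, then `-(R B - 1)` acts as the identity on `ker B`, so the identity of
the kernel is compact and Riesz's theorem applies. -/
theorem finiteDimensional_ker_of_isUnit_calkin {B : H →L[ℂ] H} (hB : IsUnit (calkin B)) :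
    FiniteDimensional ℂ (eigenspace B 0) := by
  obtain ⟨r, hr⟩ := hB.exists_left_inv
  obtain ⟨R, rfl⟩ := calkin_surjective r
  rw [← map_mul, ← map_one calkin, calkin_eq_iff] at hr
  have hx : ∀ x : eigenspace B 0, (-(R * B - 1) : H →L[ℂ] H) (x : H) = (x : H) := by
    intro x
    have : B x = 0 := by simpa using Module.End.mem_eigenspace_iff.1 x.2
    simp [this]
  refine FiniteDimensional.of_isCompactOperator_id (𝕜 := ℂ) ?_
  have hc := (show IsCompactOperator (-(R * B - 1) : H →L[ℂ] H) from hr.neg).comp_clm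
    (eigenspace B 0).subtypeL
  have hcl : IsClosed (eigenspace B 0 : Set H) := by
    have : (eigenspace B 0 : Set H) = B ⁻¹' {0} := by
      ext x
      simp
    rw [this]
    exact isClosed_singleton.preimage B.continuous
  have := hc.codRestrict (V := eigenspace B 0)
    (fun x => (congrArg (· ∈ eigenspace B 0) (hx x)).mpr x.2) hcl
  convert! this using 1
  ext x
  exact (hx x).symm

/-- Otherwise there are unit vectors `x n` with `B (x n) → 0`. Compactness of `R B - 1` makes a
subsequence converge, and its limit is a unit vector in the kernel. -/
theorem exists_antilipschitzWith_of_isUnit_calkin {B : H →L[ℂ] H} (hB : IsUnit (calkin B))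
    (h0 : ∀ x, B x = 0 → x = 0) : ∃ K, AntilipschitzWith K B := by
  obtain ⟨r, hr⟩ := hB.exists_left_inv
  obtain ⟨R, rfl⟩ := calkin_surjective r
  rw [← map_mul, ← map_one calkin, calkin_eq_iff] at hr
  rw [antilipschitzWith_iff_exists_mul_le_norm]
  by_contra! h
  have hn : ∀ n : ℕ, ∃ x, ‖x‖ = 1 ∧ ‖B x‖ < 1 / ((n : ℝ) + 1) := by
    intro n
    obtain ⟨x, hx⟩ := h (1 / ((n : ℝ) + 1)) (by positivity)
    have hx0 : 0 < ‖x‖ := by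
      rw [norm_pos_iff]
      rintro rfl
      simp at hx
    refine ⟨((‖x‖⁻¹ : ℝ) : ℂ) • x, ?_, ?_⟩
    · rw [norm_smul]
      simp [hx0.ne']
    · rw [map_smul, norm_smul]
      simp only [Complex.norm_real, norm_inv, norm_norm]
      rwa [inv_mul_lt_iff₀ hx0, mul_comm]
  choose x hx1 hx2 using hn
  have hlim : Tendsto (fun n => B (x n)) atTop (𝓝 0) :=
    squeeze_zero_norm (fun n => (hx2 n).le) tendsto_one_div_add_atTop_nhds_zero_nat
  obtain ⟨C, hC, hC'⟩ := hr.image_closedBall_subset_compact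
    (f := ((R * B - 1 : H →L[ℂ] H) : H →ₗ[ℂ] H)) 1
  obtain ⟨y, -, φ, hφ, hy⟩ := hC.tendsto_subseq (x := fun n => (R * B - 1 : H →L[ℂ] H) (x n))
    (fun n => hC' ⟨x n, by simp [hx1], rfl⟩)
  -- Here `x = R (B x) - (R B - 1) x`, with the first term tending to `0` and the second to `y`.
  have hxy : Tendsto (fun n => x (φ n)) atTop (𝓝 (-y)) := by
    have h1 : Tendsto (fun n => R (B (x (φ n)))) atTop (𝓝 0) := by
      have := (R.continuous.tendsto 0).comp (hlim.comp hφ.tendsto_atTop)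
      rwa [map_zero] at this
    have := h1.sub hy
    simpa using this
  have hy0 : B (-y) = 0 :=
    tendsto_nhds_unique ((B.continuous.tendsto _).comp hxy) (hlim.comp hφ.tendsto_atTop)
  have hy1 : ‖-y‖ = 1 := tendsto_nhds_unique hxy.norm (by simp [hx1])
  rw [h0 _ hy0] at hy1
  simp at hy1

variable [CompleteSpace H]

/-- If `T⋆ T` is compact, so is `T`. -/
theorem isCompactOperator_of_adjoint_comp_self {T : H →L[ℂ] H}
    (h : IsCompactOperator (T.adjoint ∘L T)) : IsCompactOperator T := by
  have hc := (h.isCompact_closure_image_ball (f := ((T.adjoint ∘L T : H →L[ℂ] H) : H →ₗ[ℂ] H)) 1)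
  refine (isCompactOperator_iff_isCompact_closure_image_ball (T : H →ₗ[ℂ] H) one_pos).2 ?_
  refine TotallyBounded.isCompact_of_isClosed (TotallyBounded.closure ?_) isClosed_closure
  have ht := hc.totallyBounded.subset subset_closure
  rw [totallyBounded_iff_subset] at ht
  rw [Metric.totallyBounded_iff]
  intro ε hε
  -- The radius comes from `‖T z‖² ≤ ‖T⋆ T z‖ ‖z‖`, applied to differences `z` of two vectors of the
  -- unit ball, for which `‖z‖ ≤ 2`.
  obtain ⟨t, hts, htf, hcov⟩ := ht _ (Metric.dist_mem_uniformity (show 0 < ε ^ 2 / 2 by positivity))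
  have hts' : ∀ y : H, ∃ x, y ∈ t → ‖x‖ < 1 ∧ T.adjoint (T x) = y := by
    intro y
    by_cases hy : y ∈ t
    · obtain ⟨x, hx, hxy⟩ := hts hy
      exact ⟨x, fun _ => ⟨mem_ball_zero_iff.1 hx, hxy⟩⟩
    · exact ⟨0, fun h => absurd h hy⟩
  choose g hg using hts'
  refine ⟨(fun y => T (g y)) '' t, htf.image _, ?_⟩
  rintro _ ⟨x, hx, rfl⟩
  obtain ⟨y, hy, hxy⟩ := Set.mem_iUnion₂.1 (hcov ⟨x, hx, rfl⟩)
  refine Set.mem_iUnion₂.2 ⟨_, ⟨y, hy, rfl⟩, ?_⟩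
  obtain ⟨hg1, hg2⟩ := hg y hy
  rw [mem_ball_zero_iff] at hx
  have h1 : ‖T.adjoint (T (x - g y))‖ < ε ^ 2 / 2 := by
    rw [map_sub, map_sub, hg2, ← dist_eq_norm]
    exact hxy
  have h2 : ‖x - g y‖ ≤ 2 := (norm_sub_le _ _).trans (by linarith)
  have h3 : ‖T (x - g y)‖ ^ 2 ≤ ‖T.adjoint (T (x - g y))‖ * ‖x - g y‖ := by
    rw [ContinuousLinearMap.apply_norm_sq_eq_inner_adjoint_left]
    exact (Complex.re_le_norm _).trans (norm_inner_le_norm _ _)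
  have h4 : ‖T (x - g y)‖ ^ 2 < ε ^ 2 := by
    nlinarith [mul_le_mul_of_nonneg_left h2 (norm_nonneg (T.adjoint (T (x - g y))))]
  have h5 := lt_of_pow_lt_pow_left₀ 2 hε.le h4
  rwa [map_sub, ← dist_eq_norm] at h5

/-- Schauder's theorem: for `T⋆` the criterion above asks for compactness of `T T⋆`, which is clear.
-/
theorem isCompactOperator_adjoint {T : H →L[ℂ] H} (h : IsCompactOperator T) :
    IsCompactOperator T.adjoint := by
  apply isCompactOperator_of_adjoint_comp_self
  rw [ContinuousLinearMap.adjoint_adjoint]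
  exact h.comp_clm T.adjoint

end Compact

/-! ### Symmetries, invariant subspaces and compatible skew-adjoint operators. -/

section Algebra

variable {S : SymType} {E : Type u} [NormedAddCommGroup E] [InnerProductSpace ℂ E]

/-- The sign with which a symmetry commutes with `W - W⋆` for a symmetric `W`. -/
def SymKind.sign : SymKind → ℤ
  | .eta => 1
  | .tau => -1
  | .gamma => -1

theorem SymKind.sign_mul_self (k : SymKind) : k.sign * k.sign = 1 := by
  cases k <;> rfl

theorem SymType.sq_mul_self {k : SymKind} (h : S.Has k) : S.sq k * S.sq k = 1 := by
  cases S <;> cases k <;> first | rfl | exact absurd rfl h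

theorem SymRep.op_zsmul (ρ : SymRep S E) (k h) (n : ℤ) (x : E) :
    ρ.op k h (n • x) = n • ρ.op k h x :=
  map_zsmul (AddMonoidHom.mk' (ρ.op k h) (ρ.map_add k h)) n x

theorem SymRep.op_op_sq_smul (ρ : SymRep S E) (k h) (x : E) :
    ρ.op k h (S.sq k • ρ.op k h x) = x := by
  rw [ρ.op_zsmul, ρ.sq, smul_smul, SymType.sq_mul_self h, one_smul]

theorem SymRep.op_surjective (ρ : SymRep S E) (k h) : Function.Surjective (ρ.op k h) :=
  fun x => ⟨_, ρ.op_op_sq_smul k h x⟩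

theorem SymRep.inner_op_op (ρ : SymRep S E) (k h) (x y : E) :
    ⟪ρ.op k h x, ρ.op k h y⟫_ℂ = k.twist ⟪x, y⟫_ℂ := by
  cases k with
  | eta => rw [ρ.inner_op _ _ rfl, SymKind.twist, inner_conj_symm]
  | tau => rw [ρ.inner_op _ _ rfl, SymKind.twist, inner_conj_symm]
  | gamma =>
    exact (LinearIsometry.mk (ρ.chi h) (ρ.norm_map _ h)).inner_map_map x y

theorem SymRep.Invariant.op_mem_iff {ρ : SymRep S E} {N : Submodule ℂ E} (hN : ρ.Invariant N)
    {k h} {x : E} : ρ.op k h x ∈ N ↔ x ∈ N := by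
  refine ⟨fun hx => ?_, hN k h x⟩
  have := hN k h _ hx
  rw [ρ.sq] at this
  have h2 := zsmul_mem this (S.sq k)
  rwa [smul_smul, SymType.sq_mul_self h, one_smul] at h2

theorem SymRep.Invariant.orthogonal {ρ : SymRep S E} {N : Submodule ℂ E} (hN : ρ.Invariant N) :
    ρ.Invariant Nᗮ := by
  intro k h x hx
  rw [Submodule.mem_orthogonal] at hx ⊢
  intro y hy
  obtain ⟨z, rfl⟩ := ρ.op_surjective k h y
  rw [ρ.inner_op_op, hx z (hN.op_mem_iff.1 hy), map_zero]

theorem SymRep.Invariant.inf {ρ : SymRep S E} {M N : Submodule ℂ E} (hM : ρ.Invariant M)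
    (hN : ρ.Invariant N) : ρ.Invariant (M ⊓ N) :=
  fun k h x hx => ⟨hM k h x hx.1, hN k h x hx.2⟩

theorem SymRep.Invariant.sup {ρ : SymRep S E} {M N : Submodule ℂ E} (hM : ρ.Invariant M)
    (hN : ρ.Invariant N) : ρ.Invariant (M ⊔ N) := by
  intro k h x hx
  obtain ⟨y, hy, z, hz, rfl⟩ := Submodule.mem_sup.1 hx
  rw [ρ.map_add]
  exact Submodule.add_mem_sup (hM k h y hy) (hN k h z hz)

/-- Both `N` and its orthogonal complement are invariant, so a symmetry respects the orthogonal
decomposition of `x`. -/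
theorem SymRep.Invariant.op_starProjection {ρ : SymRep S E} {N : Submodule ℂ E}
    (hN : ρ.Invariant N) [N.HasOrthogonalProjection] (k h) (x : E) :
    ρ.op k h (N.starProjection x) = N.starProjection (ρ.op k h x) := by
  refine (Submodule.eq_starProjection_of_mem_orthogonal
    (hN k h _ (N.starProjection_apply_mem x)) ?_).symm
  rw [← ρ.op_sub]
  exact hN.orthogonal k h _ (N.sub_starProjection_mem_orthogonal x)

/-- Skew-adjoint operators which commute with the symmetries up to the signs `SymKind.sign`. -/
structure SymRep.SkewCompatible (ρ : SymRep S E) (B : E →L[ℂ] E) : Prop where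
  skew : ∀ x y, ⟪B x, y⟫_ℂ = -⟪x, B y⟫_ℂ
  comm : ∀ k h x, ρ.op k h (B x) = k.sign • B (ρ.op k h x)

theorem SymRep.SkewCompatible.invariant_comap {ρ : SymRep S E} {B : E →L[ℂ] E}
    (hB : ρ.SkewCompatible B) {N : Submodule ℂ E} (hN : ρ.Invariant N) :
    ρ.Invariant (N.comap (B : E →ₗ[ℂ] E)) := by
  intro k h x hx
  have h1 := zsmul_mem (hN k h _ hx) k.sign
  rw [ContinuousLinearMap.coe_coe, hB.comm, smul_smul, k.sign_mul_self, one_smul] at h1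
  exact h1

theorem notMem_spectrum_of_forall_eq_smul [FiniteDimensional ℂ E] (T : E →L[ℂ] E) (c : ℂ)
    (h : ∀ x, T x = c • x → x = 0) : c ∉ spectrum ℂ T := by
  rw [spectrum.notMem_iff]
  have : CompleteSpace E := FiniteDimensional.complete ℂ E
  rw [ContinuousLinearMap.isUnit_iff_bijective]
  have hi : Function.Injective ((algebraMap ℂ (E →L[ℂ] E) c - T : E →L[ℂ] E) : E →ₗ[ℂ] E) := by
    rw [← LinearMap.ker_eq_bot, LinearMap.ker_eq_bot']
    intro x hx
    apply h
    rw [ContinuousLinearMap.coe_coe, sub_apply, sub_eq_zero,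
      Algebra.algebraMap_eq_smul_one] at hx
    exact hx.symm
  exact ⟨hi, LinearMap.injective_iff_surjective.1 hi⟩

theorem isUnit_of_injective [FiniteDimensional ℂ E] (T : E →L[ℂ] E)
    (h : ∀ x, T x = 0 → x = 0) : IsUnit T := by
  have := notMem_spectrum_of_forall_eq_smul T 0 (fun x hx => h x (by rw [hx, zero_smul]))
  rw [spectrum.notMem_iff] at this
  simpa using this

theorem SymRep.SkewCompatible.adjoint_eq [CompleteSpace E] {ρ : SymRep S E} {B : E →L[ℂ] E}
    (hB : ρ.SkewCompatible B) : B.adjoint = -B := by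
  refine (ContinuousLinearMap.eq_adjoint_iff _ _ |>.2 fun x y => ?_).symm
  rw [neg_apply, inner_neg_left, hB.skew, neg_neg]

/-- An injective compatible skew-adjoint operator makes a representation balanced: its Cayley
transform is a gapped unitary. -/
theorem FinRep.balanced_of_skewCompatible (F : FinRep.{u} S) (B : F.carrier →L[ℂ] F.carrier)
    (hB : F.rep.SkewCompatible B) (h0 : ∀ x, B x = 0 → x = 0) : F.Balanced := by
  have hre : ∀ x, ⟪B x, x⟫_ℂ = -⟪x, B x⟫_ℂ := fun x => hB.skew x x
  -- A skew-adjoint operator has no nonzero real eigenvalue, so `1 - B` and `1 + B` are injective,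
  -- hence invertible in finite dimension.
  obtain ⟨u, hu⟩ : IsUnit (1 - B) := by
    refine isUnit_of_injective _ fun x hx => ?_
    have hx' : B x = x := (sub_eq_zero.1 hx).symm
    have := hre x
    rw [hx', self_eq_neg] at this
    exact inner_self_eq_zero.1 this
  obtain ⟨v, hv⟩ : IsUnit (1 + B) := by
    refine isUnit_of_injective _ fun x hx => ?_
    have hx' : B x = -x := (neg_eq_of_add_eq_zero_right hx).symm
    have := hre x
    rw [hx', inner_neg_left, inner_neg_right, neg_neg, neg_eq_self] at this
    exact inner_self_eq_zero.1 this
  have hadj : star B = -B := hB.adjoint_eq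
  have hcomm : Commute u v := by
    refine Units.ext ?_
    rw [Units.val_mul, Units.val_mul, hu, hv]
    noncomm_ring
  have hsu : star u = v := Units.ext (by rw [Units.coe_star, hu, hv, star_sub, star_one, hadj,
    sub_neg_eq_add])
  have hsv : star v = u := by rw [← hsu, star_star]
  have hstar : star (v * u⁻¹) = v⁻¹ * u := by rw [star_mul, star_inv, hsu, hsv]
  have hl : star (v * u⁻¹) * (v * u⁻¹) = 1 := by
    rw [hstar, mul_assoc, ← mul_assoc u, hcomm.eq]
    group
  have hr : (v * u⁻¹) * star (v * u⁻¹) = 1 := by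
    rw [hstar, mul_assoc, ← mul_assoc u⁻¹, (hcomm.inv_left.inv_right).eq]
    group
  -- The Cayley transform `(1 + B) (1 - B)⁻¹`. Its factors commute and are adjoint to each other,
  -- which gives unitarity.
  set U : F.carrier →L[ℂ] F.carrier := ((v * u⁻¹ : (F.carrier →L[ℂ] F.carrier)ˣ) :
    F.carrier →L[ℂ] F.carrier) with hU
  have hl' : star U * U = 1 := congrArg Units.val hl
  have hr' : U * star U = 1 := congrArg Units.val hr
  have hUy : ∀ y, U (y - B y) = y + B y := by
    intro y
    have : U * (1 - B) = 1 + B := by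
      rw [hU, ← hu, ← hv, ← Units.val_mul, inv_mul_cancel_right]
    exact congrArg (fun T : F.carrier →L[ℂ] F.carrier => T y) this
  have hUsy : ∀ y, U.adjoint (y + B y) = y - B y := by
    intro y
    rw [← hUy]
    exact congrArg (fun T : F.carrier →L[ℂ] F.carrier => T (y - B y)) hl'
  -- With every vector in the form `y - B y`, all remaining claims follow from `U (y - B y) = y + B
  -- y` and its adjoint version.
  have hsurj : ∀ x, ∃ y, x = y - B y := by
    intro x
    refine ⟨((u⁻¹ : (F.carrier →L[ℂ] F.carrier)ˣ) : F.carrier →L[ℂ] F.carrier) x, ?_⟩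
    have : (u : F.carrier →L[ℂ] F.carrier) * (u⁻¹ : (F.carrier →L[ℂ] F.carrier)ˣ) = 1 := u.mul_inv
    rw [hu] at this
    exact (congrArg (fun T : F.carrier →L[ℂ] F.carrier => T x) this).symm
  refine ⟨U, ⟨hl', hr'⟩, ?_, ?_, ?_⟩
  · intro k h x
    obtain ⟨y, rfl⟩ := hsurj x
    rw [hUy, F.rep.map_add, F.rep.op_sub, hB.comm]
    cases k
    · simp only [SymKind.sign, one_smul, SymKind.image, hUy]
    · simp only [SymKind.sign, neg_smul, one_smul, SymKind.image, sub_neg_eq_add, hUsy]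
      exact (sub_eq_add_neg _ _).symm
    · simp only [SymKind.sign, neg_smul, one_smul, SymKind.image, sub_neg_eq_add, hUsy]
      exact (sub_eq_add_neg _ _).symm
  · refine notMem_spectrum_of_forall_eq_smul _ _ fun x hx => ?_
    obtain ⟨y, rfl⟩ := hsurj x
    rw [hUy, one_smul] at hx
    -- Only the eigenvalue `1` needs injectivity of `B`; for `-1` the equation gives `y = 0`
    -- directly.
    have hy : B y = 0 := by linear_combination (norm := module) (1 / 2 : ℂ) • hx
    rw [h0 y hy, map_zero, sub_zero]
  · refine notMem_spectrum_of_forall_eq_smul _ _ fun x hx => ?_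
    obtain ⟨y, rfl⟩ := hsurj x
    rw [hUy, neg_smul, one_smul] at hx
    have hy : y = 0 := by linear_combination (norm := module) (1 / 2 : ℂ) • hx
    rw [hy, map_zero, sub_zero]

end Algebra

/-! ### Relations in the index group and invariance under linear equivalence. -/

section IndexGroup

variable {S : SymType}

theorem FinRep.index_sum (F G : FinRep.{u} S) : (F.sum G).index = F.index + G.index := by
  refine QuotientAddGroup.eq_iff_sub_mem.2 (AddSubgroup.subset_closure ?_)
  exact Or.inl (Or.inr ⟨F, G, rfl⟩)

theorem FinRep.index_of_balanced {F : FinRep.{u} S} (hF : F.Balanced) : F.index = 0 := by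
  refine (QuotientAddGroup.eq_zero_iff _).2 (AddSubgroup.subset_closure ?_)
  exact Or.inr ⟨F, hF, rfl⟩

/-- The representation with the signs of `tau` and `gamma` reversed. -/
def SymRep.flip {E : Type u} [NormedAddCommGroup E] [InnerProductSpace ℂ E]
    (ρ : SymRep S E) : SymRep S E where
  op k h x := k.sign • ρ.op k h x
  map_add k h x y := by rw [ρ.map_add, smul_add]
  map_smul k h c x := by rw [ρ.map_smul, smul_comm]
  norm_map k h x := by
    cases k <;> simp [SymKind.sign, ρ.norm_map]
  sq k h x := by rw [ρ.op_zsmul, ρ.sq, smul_smul, k.sign_mul_self, one_smul]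
  eta_tau he ht hg x := by
    rw [ρ.op_zsmul, ρ.eta_tau he ht hg, smul_smul]
    rfl
  tau_eta he ht hg x := by
    rw [ρ.op_zsmul, ρ.tau_eta he ht hg, smul_smul]
    rfl

/-- The finite dimensional representation with the signs of `tau` and `gamma` reversed. -/
def FinRep.flip (F : FinRep.{u} S) : FinRep.{u} S where
  carrier := F.carrier
  rep := F.rep.flip

/-- Symmetries preserve inner products up to the twist, and every test vector is the image of
another under the symmetry. -/
theorem adjoint_intertwines {E F : Type u} [NormedAddCommGroup E] [InnerProductSpace ℂ E]
    [CompleteSpace E] [NormedAddCommGroup F] [InnerProductSpace ℂ F] [CompleteSpace F]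
    (ρ : SymRep S E) (π : SymRep S F) (L : E →L[ℂ] F)
    (hL : ∀ k h x, L (ρ.op k h x) = π.op k h (L x)) (k h) (y : F) :
    L.adjoint (π.op k h y) = ρ.op k h (L.adjoint y) := by
  refine ext_inner_right ℂ fun x => ?_
  obtain ⟨x, rfl⟩ := ρ.op_surjective k h x
  rw [ContinuousLinearMap.adjoint_inner_left, hL, π.inner_op_op, ρ.inner_op_op,
    ContinuousLinearMap.adjoint_inner_left]

/-- On the sum the operator `(x, y) ↦ (-L⋆ y, L x)` is skew-adjoint and injective. Being
off-diagonal, it picks up exactly the required signs once the second factor is flipped, so the sum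
is balanced. The intertwiner `L` need not be unitary. -/
theorem FinRep.index_add_index_flip (F G : FinRep.{u} S) (L : F.carrier →L[ℂ] G.carrier)
    (hL : ∀ k h x, L (F.rep.op k h x) = G.rep.op k h (L x)) (hbij : Function.Bijective L) :
    F.index + G.flip.index = 0 := by
  rw [← FinRep.index_sum]
  apply FinRep.index_of_balanced
  let B : WithLp 2 (F.carrier × G.carrier) →ₗ[ℂ] WithLp 2 (F.carrier × G.carrier) :=
    { toFun := fun x => WithLp.toLp 2 (-L.adjoint x.snd, L x.fst)
      map_add' := fun x y => WithLp.ofLp_injective 2 (Prod.ext (by simp; abel) (by simp))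
      map_smul' := fun c x => WithLp.ofLp_injective 2 (Prod.ext (by simp) (by simp)) }
  have hadj := adjoint_intertwines F.rep G.rep L hL
  suffices (FinRep.mk (WithLp 2 (F.carrier × G.carrier)) (F.rep.sum G.rep.flip)).Balanced from this
  let B' : WithLp 2 (F.carrier × G.carrier) →L[ℂ] WithLp 2 (F.carrier × G.carrier) :=
    LinearMap.toContinuousLinearMap B
  refine FinRep.balanced_of_skewCompatible _ B' ⟨?_, ?_⟩ ?_
  · intro x y
    change ⟪B x, y⟫_ℂ = -⟪x, B y⟫_ℂ
    rw [WithLp.prod_inner_apply, WithLp.prod_inner_apply]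
    change ⟪-L.adjoint x.snd, y.fst⟫_ℂ + ⟪L x.fst, y.snd⟫_ℂ =
      -(⟪x.fst, -L.adjoint y.snd⟫_ℂ + ⟪x.snd, L y.fst⟫_ℂ)
    rw [inner_neg_left, inner_neg_right, ContinuousLinearMap.adjoint_inner_left,
      ContinuousLinearMap.adjoint_inner_right]
    ring
  · intro k h x
    refine WithLp.ofLp_injective 2 (Prod.ext ?_ ?_)
    · change F.rep.op k h (-L.adjoint x.snd) =
        k.sign • (-L.adjoint (k.sign • G.rep.op k h x.snd))
      rw [map_zsmul, ← smul_neg, smul_smul, k.sign_mul_self, one_smul, F.rep.op_neg, hadj]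
    · change k.sign • G.rep.op k h (L x.fst) = k.sign • L (F.rep.op k h x.fst)
      rw [hL]
  · intro x hx
    have h1 : -L.adjoint x.snd = 0 := congrArg WithLp.fst hx
    have h2 : L x.fst = 0 := congrArg WithLp.snd hx
    rw [neg_eq_zero] at h1
    refine WithLp.ofLp_injective 2 (Prod.ext (hbij.1 (h2.trans (map_zero L).symm)) ?_)
    obtain ⟨z, hz⟩ := hbij.2 x.snd
    have : ⟪L.adjoint x.snd, z⟫_ℂ = 0 := by rw [h1, inner_zero_left]
    rw [ContinuousLinearMap.adjoint_inner_left, hz] at this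
    exact inner_self_eq_zero.1 this

/-- The index is invariant under linear, not necessarily unitary, equivalence. -/
theorem FinRep.index_eq_of_bijective (F G : FinRep.{u} S) (L : F.carrier →ₗ[ℂ] G.carrier)
    (hL : ∀ k h x, L (F.rep.op k h x) = G.rep.op k h (L x)) (hbij : Function.Bijective L) :
    F.index = G.index := by
  -- The class of `G.flip` is inverse to that of `F` through `L`, and to that of `G` through the
  -- identity.
  have h1 := F.index_add_index_flip G (LinearMap.toContinuousLinearMap L) hL hbij
  have h2 := G.index_add_index_flip G (ContinuousLinearMap.id ℂ _) (fun _ _ _ => rfl)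
    Function.bijective_id
  exact add_right_cancel (h1.trans h2.symm)

end IndexGroup


/-! ### Indices of invariant subspaces and stability of the index of a kernel. -/

section IndexOn

variable {S : SymType} {H : Type u} [NormedAddCommGroup H] [InnerProductSpace ℂ H]
  {ρ : SymRep S H}

theorem mem_eigenspace_zero {B : H →L[ℂ] H} {x : H} : x ∈ eigenspace B 0 ↔ B x = 0 := by
  simp

/-- The representation on a finite dimensional invariant subspace. -/
noncomputable def SymRep.HasIndexOn.toFinRep {N : Submodule ℂ H} (h : ρ.HasIndexOn N) : FinRep.{u} S :=
  haveI := h.1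
  FinRep.mk N (ρ.restrict N h.2)

theorem SymRep.HasIndexOn.indexOn_eq {N : Submodule ℂ H} (h : ρ.HasIndexOn N) :
    ρ.indexOn N = h.toFinRep.index :=
  dif_pos h

theorem SymRep.HasIndexOn.mono {M N : Submodule ℂ H} (h : ρ.HasIndexOn N) (hMN : M ≤ N)
    (hM : ρ.Invariant M) : ρ.HasIndexOn M :=
  haveI := h.1
  ⟨Submodule.finiteDimensional_of_le hMN, hM⟩

theorem SymRep.HasIndexOn.sup {M N : Submodule ℂ H} (hM : ρ.HasIndexOn M)
    (hN : ρ.HasIndexOn N) : ρ.HasIndexOn (M ⊔ N) :=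
  haveI := hM.1
  haveI := hN.1
  ⟨inferInstance, hM.2.sup hN.2⟩

theorem SymRep.hasIndexOn_bot : ρ.HasIndexOn ⊥ :=
  ⟨inferInstance, fun k h x hx => by rw [Submodule.mem_bot] at hx ⊢; rw [hx, ρ.op_zero]⟩

/-- The addition map from the Hilbert sum to `M ⊔ N` is a bijective intertwiner. It is unitary only
for orthogonal subspaces, so invariance under linear equivalence is what lets disjointness suffice.
-/
theorem SymRep.HasIndexOn.indexOn_sup {M N : Submodule ℂ H} (hM : ρ.HasIndexOn M)
    (hN : ρ.HasIndexOn N) (hd : Disjoint M N) :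
    ρ.indexOn (M ⊔ N) = ρ.indexOn M + ρ.indexOn N := by
  rw [hM.indexOn_eq, hN.indexOn_eq, (hM.sup hN).indexOn_eq, ← FinRep.index_sum]
  symm
  let L : WithLp 2 (M × N) →ₗ[ℂ] (M ⊔ N : Submodule ℂ H) :=
    { toFun := fun x => ⟨x.fst + x.snd, Submodule.add_mem_sup x.fst.2 x.snd.2⟩
      map_add' := fun x y => Subtype.ext (by simp; abel)
      map_smul' := fun c x => Subtype.ext (by simp) }
  refine FinRep.index_eq_of_bijective _ _ L ?_ ⟨?_, ?_⟩
  · intro k h x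
    exact Subtype.ext (ρ.map_add k h _ _).symm
  · refine (injective_iff_map_eq_zero L).2 fun x hx => ?_
    have h0 : (x.fst : H) + x.snd = 0 := congrArg Subtype.val hx
    have h1 : (x.fst : H) = 0 := by
      refine (Submodule.disjoint_def.1 hd) _ x.fst.2 ?_
      rw [eq_neg_of_add_eq_zero_left h0]
      exact N.neg_mem x.snd.2
    rw [h1, zero_add] at h0
    exact WithLp.ofLp_injective 2 (Prod.ext (Subtype.ext h1) (Subtype.ext h0))
  · rintro ⟨x, hx⟩
    obtain ⟨y, hy, z, hz, rfl⟩ := Submodule.mem_sup.1 hx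
    exact ⟨WithLp.toLp 2 (⟨y, hy⟩, ⟨z, hz⟩), rfl⟩

/-- By additivity for `⊥ ⊔ ⊥ = ⊥` the index equals its double. -/
theorem SymRep.indexOn_bot : ρ.indexOn ⊥ = 0 := by
  have := (ρ.hasIndexOn_bot).indexOn_sup ρ.hasIndexOn_bot disjoint_bot_left
  rwa [sup_bot_eq, left_eq_add] at this

theorem SymRep.HasIndexOn.indexOn_eq_of_bijOn {M N : Submodule ℂ H} (hM : ρ.HasIndexOn M)
    (hN : ρ.HasIndexOn N) (T : H →ₗ[ℂ] H) (hT : Set.BijOn T M N)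
    (hc : ∀ k h x, T (ρ.op k h x) = ρ.op k h (T x)) : ρ.indexOn M = ρ.indexOn N := by
  rw [hM.indexOn_eq, hN.indexOn_eq]
  refine FinRep.index_eq_of_bijective _ _ (T.restrict hT.mapsTo : M →ₗ[ℂ] N) ?_ ⟨?_, ?_⟩
  · intro k h x
    exact Subtype.ext (hc k h _)
  · intro x y hxy
    exact Subtype.ext (hT.injOn x.2 y.2 (congrArg Subtype.val hxy))
  · rintro ⟨y, hy⟩
    obtain ⟨x, hx, rfl⟩ := hT.surjOn hy
    exact ⟨⟨x, hx⟩, rfl⟩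

/-- A finite dimensional invariant subspace on which a compatible skew form is nondegenerate
has index zero. -/
theorem SymRep.HasIndexOn.indexOn_eq_zero {M : Submodule ℂ H} (hM : ρ.HasIndexOn M)
    {B : H →L[ℂ] H} (hB : ρ.SkewCompatible B) (hnd : ∀ x ∈ M, B x ∈ Mᗮ → x = 0) :
    ρ.indexOn M = 0 := by
  rw [hM.indexOn_eq]
  apply FinRep.index_of_balanced
  have := hM.1
  -- The compression of `B` to `M`: it inherits skewness and compatibility, and `C x = 0` means that
  -- `B x` is orthogonal to `M`.
  let C : M →L[ℂ] M := M.orthogonalProjectionOnto ∘L B ∘L M.subtypeL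
  have hC : ∀ x : M, (C x : H) = M.starProjection (B x) := fun x => rfl
  have hskew : ∀ x y : M, ⟪(C x : H), (y : H)⟫_ℂ = -⟪(x : H), (C y : H)⟫_ℂ := by
    intro x y
    rw [hC, hC, Submodule.inner_starProjection_left_eq_right,
      ← Submodule.inner_starProjection_left_eq_right M (x : H),
      Submodule.starProjection_eq_self_iff.2 x.2, Submodule.starProjection_eq_self_iff.2 y.2,
      hB.skew]
  have hcomm : ∀ k h (x : M), ρ.op k h (C x : H) =
      k.sign • M.starProjection (B (ρ.op k h (x : H))) := by
    intro k h x
    rw [hC, hM.2.op_starProjection, hB.comm, map_zsmul]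
  have hker : ∀ x : M, C x = 0 → x = 0 := by
    intro x hx
    refine Subtype.ext (hnd _ x.2 ?_)
    rw [← Submodule.starProjection_apply_eq_zero_iff]
    exact congrArg Subtype.val hx
  exact FinRep.balanced_of_skewCompatible hM.toFinRep C
    ⟨fun x y => hskew x y, fun k h x => Subtype.ext (hcomm k h x)⟩ hker

/-- The index of a finite dimensional invariant subspace is carried by the radical of any
compatible skew form on it. -/
theorem SymRep.HasIndexOn.indexOn_radical {M : Submodule ℂ H} (hM : ρ.HasIndexOn M)
    {B : H →L[ℂ] H} (hB : ρ.SkewCompatible B) :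
    ρ.indexOn (M ⊓ Mᗮ.comap (B : H →ₗ[ℂ] H)) = ρ.indexOn M := by
  set Z := M ⊓ Mᗮ.comap (B : H →ₗ[ℂ] H) with hZdef
  have hZ : ρ.HasIndexOn Z :=
    hM.mono inf_le_left (hM.2.inf (hB.invariant_comap hM.2.orthogonal))
  -- The form is nondegenerate on the complement of its radical `Z` in `M`, so this complement
  -- contributes index zero.
  have hX : ρ.HasIndexOn (Zᗮ ⊓ M) := hM.mono inf_le_right (hZ.2.orthogonal.inf hM.2)
  have := hZ.1
  have hsup : Z ⊔ Zᗮ ⊓ M = M := Submodule.sup_orthogonal_inf_of_hasOrthogonalProjection inf_le_left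
  have hd : Disjoint Z (Zᗮ ⊓ M) := Z.orthogonal_disjoint.mono_right inf_le_left
  have h0 : ρ.indexOn (Zᗮ ⊓ M) = 0 := by
    refine hX.indexOn_eq_zero hB fun x hx hBx => ?_
    refine Submodule.disjoint_def.1 hd x ⟨hx.2, ?_⟩ hx
    change B x ∈ Mᗮ
    rw [← hsup, ← Submodule.inf_orthogonal]
    -- Orthogonality of `B x` to `Z` is automatic by skewness, since `B z` is orthogonal to `M`. So
    -- `B x` is orthogonal to all of `M`, which puts `x` in both `Z` and its complement.
    refine ⟨fun z hz => ?_, hBx⟩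
    have : ⟪B z, x⟫_ℂ = 0 := (Submodule.mem_orthogonal' _ _).1 hz.2 x hx.2
    rw [hB.skew, neg_eq_zero] at this
    exact this
  conv_rhs => rw [← hsup, hZ.indexOn_sup hX hd, h0, add_zero]

theorem SymRep.SkewCompatible.add {B C : H →L[ℂ] H} (hB : ρ.SkewCompatible B)
    (hC : ρ.SkewCompatible C) : ρ.SkewCompatible (B + C) where
  skew x y := by
    rw [add_apply, add_apply, inner_add_left, inner_add_right, hB.skew, hC.skew]
    ring
  comm k h x := by
    rw [add_apply, add_apply, ρ.map_add, hB.comm, hC.comm, smul_add]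

theorem SymRep.SkewCompatible.real_smul {B : H →L[ℂ] H} (hB : ρ.SkewCompatible B) (t : ℝ) :
    ρ.SkewCompatible ((t : ℂ) • B) where
  skew x y := by
    rw [smul_apply, smul_apply, inner_smul_left, inner_smul_right, hB.skew, Complex.conj_ofReal]
    ring
  comm k h x := by
    have : k.twist (t : ℂ) = t := by cases k <;> simp [SymKind.twist]
    rw [smul_apply, smul_apply, ρ.map_smul, hB.comm, this, smul_comm]

theorem SymRep.SkewCompatible.sub {B C : H →L[ℂ] H} (hB : ρ.SkewCompatible B)
    (hC : ρ.SkewCompatible C) : ρ.SkewCompatible (B - C) := by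
  have := hB.add (hC.real_smul (-1))
  rwa [Complex.ofReal_neg, Complex.ofReal_one, neg_one_smul, ← sub_eq_add_neg] at this

/-- Compression to an invariant subspace. -/
theorem SymRep.SkewCompatible.compression {B : H →L[ℂ] H} (hB : ρ.SkewCompatible B)
    {N : Submodule ℂ H} [N.HasOrthogonalProjection] (hN : ρ.Invariant N) :
    ρ.SkewCompatible (N.starProjection ∘L B ∘L N.starProjection) where
  skew x y := by
    simp only [ContinuousLinearMap.comp_apply]
    rw [Submodule.inner_starProjection_left_eq_right, hB.skew,
      Submodule.inner_starProjection_left_eq_right]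
  comm k h x := by
    simp only [ContinuousLinearMap.comp_apply]
    rw [hN.op_starProjection, hB.comm, map_zsmul, hN.op_starProjection]

theorem SymRep.SkewCompatible.invariant_ker {B : H →L[ℂ] H} (hB : ρ.SkewCompatible B) :
    ρ.Invariant (eigenspace B 0) := by
  intro k h x hx
  rw [mem_eigenspace_zero] at hx ⊢
  have := hB.comm k h x
  rw [hx, ρ.op_zero] at this
  have h2 := congrArg (k.sign • ·) this
  simpa only [smul_smul, k.sign_mul_self, one_smul, smul_zero] using h2.symm

theorem SymRep.SkewCompatible.hasIndexOn_ker {B : H →L[ℂ] H} (hB : ρ.SkewCompatible B)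
    (hu : IsUnit (calkin B)) : ρ.HasIndexOn (eigenspace B 0) :=
  ⟨finiteDimensional_ker_of_isUnit_calkin hu, hB.invariant_ker⟩

variable [CompleteSpace H]

/-- If the compression of `B` to the orthogonal complement of `N` is invertible, the kernel of `B`
has the same index as `N`. -/
theorem SymRep.SkewCompatible.indexOn_ker_eq {B : H →L[ℂ] H} (hB : ρ.SkewCompatible B)
    {N : Submodule ℂ H} (hN : ρ.HasIndexOn N) [N.HasOrthogonalProjection]
    (hD : IsUnit ((1 - N.starProjection) * B * (1 - N.starProjection) + N.starProjection)) :
    ρ.indexOn (eigenspace B 0) = ρ.indexOn N := by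
  set P := N.starProjection with hP
  have hD' : ∀ x, ((1 - P) * B * (1 - P) + P) x = B (x - P x) - P (B (x - P x)) + P x :=
    fun x => rfl
  have hPP : ∀ x, P (P x) = P x := fun x =>
    Submodule.starProjection_eq_self_iff.2 (N.starProjection_apply_mem x)
  have hPN : ∀ {x}, P x = x ↔ x ∈ N := Submodule.starProjection_eq_self_iff
  have hbij := ContinuousLinearMap.isUnit_iff_bijective.1 hD
  have hinj : ∀ x, B x ∈ N → P x = 0 → x = 0 := by
    intro x hx hPx
    refine hbij.1 ?_
    rw [hD', map_zero, hPx, sub_zero, hPN.2 hx, sub_self, add_zero]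
  -- The Schur complement: the vectors sent into `N` by `B` form a graph over `N`, and `P` is the
  -- projection of this graph to its base.
  have hbijOn : Set.BijOn (P : H →ₗ[ℂ] H) (N.comap (B : H →ₗ[ℂ] H) : Submodule ℂ H) N := by
    refine ⟨fun x _ => N.starProjection_apply_mem x, ?_, ?_⟩
    · intro x hx y hy hxy
      refine sub_eq_zero.1 (hinj _ ?_ ?_)
      · rw [map_sub]
        exact N.sub_mem hx hy
      · rw [map_sub]
        exact sub_eq_zero.2 hxy
    · intro n hn
      -- The correction `m` cancels the part of `B n` orthogonal to `N`. Projecting its equation to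
      -- `N` shows `P m = 0`.
      obtain ⟨m, hm⟩ := hbij.2 (-(B n - P (B n)))
      rw [hD'] at hm
      have hPm : P m = 0 := by
        have := congrArg P hm
        simpa only [_root_.map_add, map_sub, map_neg, hPP, sub_self, zero_add, neg_zero] using this
      rw [hPm, sub_zero, add_zero] at hm
      refine ⟨n + m, ?_, ?_⟩
      · change B (n + m) ∈ N
        rw [← hPN, _root_.map_add, _root_.map_add]
        linear_combination (norm := module) -hm
      · change P (n + m) = n
        rw [_root_.map_add, hPm, add_zero, hPN.2 hn]
  have := hN.1
  have hM : ρ.HasIndexOn (N.comap (B : H →ₗ[ℂ] H)) := by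
    refine ⟨?_, hB.invariant_comap hN.2⟩
    refine FiniteDimensional.of_injective ((P : H →ₗ[ℂ] H).restrict hbijOn.mapsTo) ?_
    intro x y hxy
    exact Subtype.ext (hbijOn.injOn x.2 y.2 (congrArg Subtype.val hxy))
  -- The index of `N` equals that of the graph, and this in turn equals the index of the radical of
  -- `B` on the graph. It remains to see that the radical is `ker B`.
  rw [← hM.indexOn_eq_of_bijOn hN (P : H →ₗ[ℂ] H) hbijOn
    (fun k h x => (hN.2.op_starProjection k h x).symm), ← hM.indexOn_radical hB]
  congr 1
  ext x
  rw [mem_eigenspace_zero]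
  constructor
  · intro hx
    exact ⟨(congrArg (· ∈ N) hx).mpr (zero_mem _),
      (congrArg (· ∈ (N.comap (B : H →ₗ[ℂ] H))ᗮ) hx).mpr (zero_mem _)⟩
  · rintro ⟨hx1, hx2⟩
    -- Since `B x` lies in `N`, it is `P y` for some `y` in the graph, and then `0 = ⟪y, B x⟫ = ⟪P
    -- y, B x⟫ = ‖B x‖²`.
    obtain ⟨y, hy, hyx⟩ := hbijOn.surjOn hx1
    have h1 : ⟪y, B x⟫_ℂ = 0 := hx2 y hy
    rw [← hPN.2 (show B x ∈ N from hx1), hP, ← Submodule.inner_starProjection_left_eq_right] at h1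
    change ⟪P y, B x⟫_ℂ = 0 at h1
    rw [show P y = B x from hyx] at h1
    exact inner_self_eq_zero.1 h1

/-- By skewness the range of `B` is orthogonal to its kernel, so `B + P` and its adjoint `-B + P`
are both injective. Injectivity of the first, with essential invertibility, bounds it below;
injectivity of the second gives dense range. -/
theorem isUnit_add_starProjection_ker {B : H →L[ℂ] H} (hB : ρ.SkewCompatible B)
    (hu : IsUnit (calkin B)) [(eigenspace B 0).HasOrthogonalProjection] :
    IsUnit (B + (eigenspace B 0).starProjection) := by
  set N := eigenspace B 0 with hN
  set P := N.starProjection with hP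
  have hfin : FiniteDimensional ℂ N := finiteDimensional_ker_of_isUnit_calkin hu
  have hPN : ∀ {x}, P x = x ↔ x ∈ N := Submodule.starProjection_eq_self_iff
  have horth : ∀ x, B x ∈ Nᗮ := by
    intro x n hn
    have := hB.skew n x
    rwa [mem_eigenspace_zero.1 hn, inner_zero_left, zero_eq_neg] at this
  have hinj : ∀ x, B x + P x = 0 → x = 0 := by
    intro x hx
    have hPx : P x ∈ Nᗮ := by
      rw [eq_neg_of_add_eq_zero_right hx]
      exact neg_mem (horth x)
    have hPx0 : P x = 0 :=
      Submodule.disjoint_def.1 N.orthogonal_disjoint _ (N.starProjection_apply_mem x) hPx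
    rw [hPx0, add_zero] at hx
    rw [← hPN.2 (mem_eigenspace_zero.2 hx), hPx0]
  have hc : calkin (B + P) = calkin B := by
    rw [calkin_eq_iff, add_sub_cancel_left]
    exact isCompactOperator_of_finiteDimensional N P N.starProjection_apply_mem
  rw [ContinuousLinearMap.isUnit_iff_bijective,
    ContinuousLinearMap.bijective_iff_dense_range_and_antilipschitz]
  refine ⟨?_, exists_antilipschitzWith_of_isUnit_calkin (hc ▸ hu) hinj⟩
  rw [Submodule.topologicalClosure_eq_top_iff, Submodule.eq_bot_iff]
  intro y hy
  have hy' : ∀ x, ⟪B x + P x, y⟫_ℂ = 0 := fun x => hy _ ⟨x, rfl⟩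
  have h1 : P y - B y = 0 := by
    refine ext_inner_left ℂ fun x => ?_
    have := hy' x
    rw [inner_add_left, hB.skew, Submodule.inner_starProjection_left_eq_right] at this
    rw [inner_sub_right, inner_zero_right, ← this]
    ring
  have h2 : P y = 0 := by
    refine Submodule.disjoint_def.1 N.orthogonal_disjoint _ (N.starProjection_apply_mem y) ?_
    rw [sub_eq_zero.1 h1]
    exact horth y
  rw [h2, zero_sub, neg_eq_zero] at h1
  rw [← hPN.2 (mem_eigenspace_zero.2 h1), h2]

/-- At `t = 0` the compressed operator `D t` is `B + P`, which is invertible. Invertibility is an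
open condition, so the Schur complement argument applies for small `t` with the same subspace `ker
B`. -/
theorem SymRep.SkewCompatible.eventually_indexOn_ker_eq {B C : H →L[ℂ] H}
    (hB : ρ.SkewCompatible B) (hC : ρ.SkewCompatible C) (hu : IsUnit (calkin B)) :
    ∀ᶠ t : ℝ in 𝓝 0, ρ.indexOn (eigenspace (B + (t : ℂ) • C) 0) = ρ.indexOn (eigenspace B 0) := by
  have hN := hB.hasIndexOn_ker hu
  have := hN.1
  set P := (eigenspace B 0).starProjection with hP
  let D : ℝ → (H →L[ℂ] H) := fun t => (1 - P) * (B + (t : ℂ) • C) * (1 - P) + P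
  have hDc : Continuous D := by
    have : Continuous fun t : ℝ => B + (t : ℂ) • C :=
      continuous_const.add (Complex.continuous_ofReal.smul continuous_const)
    exact ((continuous_const.mul this).mul continuous_const).add continuous_const
  have hBP : B * P = 0 := by
    ext x
    exact mem_eigenspace_zero (B := B).1 ((eigenspace B 0).starProjection_apply_mem x)
  have hPB : P * B = 0 := by
    ext x
    refine (Submodule.starProjection_apply_eq_zero_iff _).2 fun n hn => ?_
    have := hB.skew n x
    rwa [mem_eigenspace_zero.1 hn, inner_zero_left, zero_eq_neg] at this
  have hD0 : IsUnit (D 0) := by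
    have : D 0 = B + P := by
      simp only [D, Complex.ofReal_zero, zero_smul, add_zero]
      rw [sub_mul, hPB, sub_zero, one_mul, mul_sub, hBP, mul_one, sub_zero]
    rw [this]
    exact isUnit_add_starProjection_ker hB hu
  filter_upwards [hDc.continuousAt.eventually (Units.isOpen.mem_nhds hD0)] with t ht
  exact (hB.add (hC.real_smul t)).indexOn_ker_eq hN ht

/-- The index of the kernel of an essentially invertible compatible skew-adjoint operator is
invariant under compact perturbations. -/
theorem SymRep.SkewCompatible.indexOn_ker_congr {B B' : H →L[ℂ] H} (hB : ρ.SkewCompatible B)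
    (hB' : ρ.SkewCompatible B') (hu : IsUnit (calkin B)) (hc : calkin B' = calkin B) :
    ρ.indexOn (eigenspace B' 0) = ρ.indexOn (eigenspace B 0) := by
  -- The straight path from `B` to `B'` stays in one Calkin class, so every operator on it is
  -- essentially invertible.
  let f : ℝ → IndexGroup.{u} S := fun t => ρ.indexOn (eigenspace (B + (t : ℂ) • (B' - B)) 0)
  have hf : IsLocallyConstant f := by
    rw [IsLocallyConstant.iff_eventually_eq]
    intro t
    have hut : calkin (B + (t : ℂ) • (B' - B)) = calkin B := by
      rw [calkin_eq_iff, add_sub_cancel_left]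
      exact (calkin_eq_iff.1 hc).smul (t : ℂ)
    have h1 := (hB.add ((hB'.sub hB).real_smul t)).eventually_indexOn_ker_eq (hB'.sub hB)
      (hut ▸ hu)
    have h2 : Tendsto (fun s : ℝ => s - t) (𝓝 t) (𝓝 0) := by
      simpa using (by fun_prop : Continuous fun s : ℝ => s - t).tendsto t
    filter_upwards [h2.eventually h1] with s hs
    change ρ.indexOn _ = ρ.indexOn _
    rw [← hs]
    congr 2
    push_cast
    module
  have := hf.apply_eq_of_isPreconnected isPreconnected_univ (Set.mem_univ 1) (Set.mem_univ 0)
  simpa [f] using this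

end IndexOn


/-! ### Block diagonal units relative to an idempotent. -/

section Ring

/-- The inverse is `u⁻¹ p + v⁻¹ (1 - p)`: elements commuting with `p` multiply blockwise. In the
Calkin algebra this glues the essential gaps of two walks. -/
theorem isUnit_mul_add_mul_one_sub {R : Type*} [Ring R] {p u v : R} (hp : p * p = p)
    (hu : IsUnit u) (hv : IsUnit v) (hup : Commute u p) (hvp : Commute v p) :
    IsUnit (u * p + v * (1 - p)) := by
  obtain ⟨u, rfl⟩ := hu
  obtain ⟨v, rfl⟩ := hv
  have hq : (1 - p) * (1 - p) = 1 - p := by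
    rw [mul_sub, mul_one, sub_mul, one_mul, hp, sub_self, sub_zero]
  have hpq : p * (1 - p) = 0 := by rw [mul_sub, mul_one, hp, sub_self]
  have hqp : (1 - p) * p = 0 := by rw [sub_mul, one_mul, hp, sub_self]
  have key : ∀ {a b c d : R}, Commute c p → Commute d p →
      (a * p + b * (1 - p)) * (c * p + d * (1 - p)) = (a * c) * p + (b * d) * (1 - p) := by
    intro a b c d hc hd
    have hd' : Commute d (1 - p) := (Commute.one_right d).sub_right hd
    have hc' : Commute c (1 - p) := (Commute.one_right c).sub_right hc
    calc (a * p + b * (1 - p)) * (c * p + d * (1 - p))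
        = a * (p * c) * p + a * (p * d) * (1 - p) + b * ((1 - p) * c) * p
          + b * ((1 - p) * d) * (1 - p) := by noncomm_ring
      _ = a * c * (p * p) + a * d * (p * (1 - p)) + b * c * ((1 - p) * p)
          + b * d * ((1 - p) * (1 - p)) := by
        rw [← hc.eq, ← hd.eq, ← hc'.eq, ← hd'.eq]
        simp only [mul_assoc]
      _ = _ := by rw [hp, hq, hpq, hqp]; simp only [mul_zero, add_zero]
  rw [isUnit_iff_exists]
  refine ⟨(u⁻¹ : Rˣ) * p + (v⁻¹ : Rˣ) * (1 - p), ?_, ?_⟩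
  · rw [key hup.units_inv_left hvp.units_inv_left]
    simp
  · rw [key hup hvp]
    simp

end Ring

/-! ### Half-line projections and their classes in the Calkin algebra. -/

namespace CellStructure

variable {S : SymType} {H : Type u} [NormedAddCommGroup H] [InnerProductSpace ℂ H]
  (𝓒 : CellStructure H) {ρ : SymRep S H}

instance (x : ℤ) : FiniteDimensional ℂ (𝓒.cell x) := 𝓒.finiteDimensional x

theorem cell_le_right {a x : ℤ} (h : a ≤ x) : 𝓒.cell x ≤ 𝓒.right a :=
  (le_iSup (fun x : {x : ℤ // a ≤ x} => 𝓒.cell x) ⟨x, h⟩).trans (Submodule.le_topologicalClosure _)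

theorem cell_le_left {a x : ℤ} (h : x < a) : 𝓒.cell x ≤ 𝓒.left a :=
  (le_iSup (fun x : {x : ℤ // x < a} => 𝓒.cell x) ⟨x, h⟩).trans (Submodule.le_topologicalClosure _)

/-- Closure and supremum disappear on passing to orthogonal complements, so orthogonality to a
half-line can be tested cell by cell. -/
theorem mem_right_orthogonal {a : ℤ} {x : H} :
    x ∈ (𝓒.right a)ᗮ ↔ ∀ y, a ≤ y → x ∈ (𝓒.cell y)ᗮ := by
  rw [right, Submodule.orthogonal_closure, ← Submodule.iInf_orthogonal, Submodule.mem_iInf]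
  exact Subtype.forall

theorem mem_left_orthogonal {a : ℤ} {x : H} :
    x ∈ (𝓒.left a)ᗮ ↔ ∀ y, y < a → x ∈ (𝓒.cell y)ᗮ := by
  rw [left, Submodule.orthogonal_closure, ← Submodule.iInf_orthogonal, Submodule.mem_iInf]
  exact Subtype.forall

theorem right_isOrtho {a : ℤ} {K : Submodule ℂ H} :
    𝓒.right a ⟂ K ↔ ∀ y, a ≤ y → 𝓒.cell y ⟂ K := by
  simp only [Submodule.isOrtho_comm (V := K), Submodule.isOrtho_iff_le, SetLike.le_def,
    mem_right_orthogonal]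
  exact ⟨fun h y hy x hx => h hx y hy, fun h x hx y hy => h y hy hx⟩

theorem left_isOrtho {a : ℤ} {K : Submodule ℂ H} :
    𝓒.left a ⟂ K ↔ ∀ y, y < a → 𝓒.cell y ⟂ K := by
  simp only [Submodule.isOrtho_comm (V := K), Submodule.isOrtho_iff_le, SetLike.le_def,
    mem_left_orthogonal]
  exact ⟨fun h y hy x hx => h hx y hy, fun h x hx y hy => h y hy hx⟩

theorem left_isOrtho_right {a b : ℤ} (hab : a ≤ b) : 𝓒.left a ⟂ 𝓒.right b := by
  rw [left_isOrtho]
  intro x hx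
  rw [Submodule.isOrtho_comm, right_isOrtho]
  exact fun y hy => 𝓒.orthogonal (by omega)

theorem left_isOrtho_cell (a : ℤ) : 𝓒.left a ⟂ 𝓒.cell a :=
  𝓒.left_isOrtho.2 fun _ hy => 𝓒.orthogonal (by omega)

theorem right_isOrtho_cell (a : ℤ) : 𝓒.right (a + 1) ⟂ 𝓒.cell a :=
  𝓒.right_isOrtho.2 fun _ hy => 𝓒.orthogonal (by omega)

theorem eq_zero_of_forall_mem_orthogonal {x : H} (h : ∀ y, x ∈ (𝓒.cell y)ᗮ) : x = 0 := by
  have hx : x ∈ ((⨆ y, 𝓒.cell y).topologicalClosure)ᗮ := by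
    rw [Submodule.orthogonal_closure, ← Submodule.iInf_orthogonal, Submodule.mem_iInf]
    exact h
  rwa [𝓒.dense, Submodule.top_orthogonal_eq_bot, Submodule.mem_bot] at hx

theorem invariant_iSup {ι : Type*} {N : ι → Submodule ℂ H} (hN : ∀ i, ρ.Invariant (N i)) :
    ρ.Invariant (⨆ i, N i) := by
  intro k h x hx
  refine Submodule.iSup_induction N (motive := fun x => ρ.op k h x ∈ ⨆ i, N i) hx ?_ ?_ ?_
  · exact fun i x hx => Submodule.mem_iSup_of_mem i (hN i k h x hx)
  · rw [ρ.op_zero]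
    exact zero_mem _
  · intro x y hx hy
    rw [ρ.map_add]
    exact add_mem hx hy

variable [CompleteSpace H]

/-- The closure is the double orthogonal complement, and complements preserve invariance. -/
theorem invariant_topologicalClosure {N : Submodule ℂ H} (hN : ρ.Invariant N) :
    ρ.Invariant N.topologicalClosure := by
  rw [← Submodule.orthogonal_orthogonal_eq_closure]
  exact hN.orthogonal.orthogonal

variable {𝓒}

theorem LocalSymmetry.invariant_right (h : 𝓒.LocalSymmetry ρ) (a : ℤ) :
    ρ.Invariant (𝓒.right a) :=
  invariant_topologicalClosure (invariant_iSup fun x => h x)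

theorem LocalSymmetry.invariant_left (h : 𝓒.LocalSymmetry ρ) (a : ℤ) :
    ρ.Invariant (𝓒.left a) :=
  invariant_topologicalClosure (invariant_iSup fun x => h x)

variable (𝓒)

theorem starProjection_left_add_right (a : ℤ) (x : H) :
    (𝓒.left a).starProjection x + (𝓒.right a).starProjection x = x := by
  have hl := 𝓒.mem_left_orthogonal.1 ((𝓒.left a).sub_starProjection_mem_orthogonal x)
  have hr := 𝓒.mem_right_orthogonal.1 ((𝓒.right a).sub_starProjection_mem_orthogonal x)
  have ho := 𝓒.left_isOrtho_right (le_refl a)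
  refine (sub_eq_zero.1 (𝓒.eq_zero_of_forall_mem_orthogonal fun y => ?_)).symm
  rcases lt_or_ge y a with hy | hy
  · rw [← sub_sub]
    refine sub_mem (hl y hy) ?_
    exact (Submodule.orthogonal_le (𝓒.cell_le_left hy)) (ho.symm ((𝓒.right a).starProjection_apply_mem x))
  · rw [← sub_sub, sub_right_comm]
    refine sub_mem (hr y hy) ?_
    exact (Submodule.orthogonal_le (𝓒.cell_le_right hy)) (ho ((𝓒.left a).starProjection_apply_mem x))

theorem starProjection_right_eq (a : ℤ) (x : H) :
    (𝓒.right a).starProjection x =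
      (𝓒.right (a + 1)).starProjection x + (𝓒.cell a).starProjection x := by
  have hsub : 𝓒.right (a + 1) ≤ 𝓒.right a :=
    Submodule.topologicalClosure_mono (iSup_le fun y => le_iSup_of_le
      (⟨y, by have := y.2; omega⟩ : {x : ℤ // a ≤ x}) le_rfl)
  refine Submodule.eq_starProjection_of_mem_orthogonal (add_mem
    (hsub (Submodule.starProjection_apply_mem _ x))
    (𝓒.cell_le_right le_rfl (Submodule.starProjection_apply_mem _ x))) ?_
  rw [mem_right_orthogonal]
  intro y hy
  rcases hy.eq_or_lt with rfl | hy
  · rw [← sub_sub, sub_right_comm]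
    refine sub_mem (Submodule.sub_starProjection_mem_orthogonal x) ?_
    exact 𝓒.right_isOrtho_cell a (Submodule.starProjection_apply_mem _ x)
  · rw [← sub_sub]
    refine sub_mem (𝓒.mem_right_orthogonal.1
      (Submodule.sub_starProjection_mem_orthogonal x) y (by omega)) ?_
    exact 𝓒.orthogonal hy.ne (Submodule.starProjection_apply_mem _ x)

theorem Plt_eq (a : ℤ) : 𝓒.Plt a = 1 - 𝓒.Pge a := by
  ext x
  exact eq_sub_of_add_eq (𝓒.starProjection_left_add_right a x)

theorem Pge_mul_self (a : ℤ) : 𝓒.Pge a * 𝓒.Pge a = 𝓒.Pge a := by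
  ext x
  exact Submodule.starProjection_eq_self_iff.2 (Submodule.starProjection_apply_mem _ x)

theorem Plt_mul_self (a : ℤ) : 𝓒.Plt a * 𝓒.Plt a = 𝓒.Plt a := by
  ext x
  exact Submodule.starProjection_eq_self_iff.2 (Submodule.starProjection_apply_mem _ x)

theorem Pge_adjoint (a : ℤ) : (𝓒.Pge a).adjoint = 𝓒.Pge a :=
  (ContinuousLinearMap.eq_adjoint_iff _ _).2
    (fun x y => Submodule.inner_starProjection_left_eq_right _ x y) |>.symm

theorem Plt_adjoint (a : ℤ) : (𝓒.Plt a).adjoint = 𝓒.Plt a :=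
  (ContinuousLinearMap.eq_adjoint_iff _ _).2
    (fun x y => Submodule.inner_starProjection_left_eq_right _ x y) |>.symm

/-- Neighbouring cuts differ by the projection onto a single cell, which has finite rank. -/
theorem calkin_Pge_eq (a b : ℤ) : calkin (𝓒.Pge a) = calkin (𝓒.Pge b) := by
  have h : ∀ a, calkin (𝓒.Pge a) = calkin (𝓒.Pge (a + 1)) := by
    intro a
    rw [calkin_eq_iff]
    refine isCompactOperator_of_finiteDimensional (𝓒.cell a) (𝓒.Pge a - 𝓒.Pge (a + 1)) fun x => ?_
    have : (𝓒.Pge a - 𝓒.Pge (a + 1)) x = (𝓒.cell a).starProjection x := by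
      rw [sub_apply, sub_eq_iff_eq_add, add_comm]
      exact 𝓒.starProjection_right_eq a x
    rw [this]
    exact Submodule.starProjection_apply_mem _ x
  have h0 : ∀ a, calkin (𝓒.Pge a) = calkin (𝓒.Pge 0) := by
    intro a
    induction a using Int.induction_on with
    | zero => rfl
    | succ n ih => rw [← h, ih]
    | pred n ih => rw [← ih, h]; congr 2; ring
  rw [h0 a, h0 b]

/-- Operators whose compressions to the half-lines vanish in norm far out have compact
compressions. -/
theorem isCompactOperator_of_tendsto_compression {l : Filter ℤ} [l.NeBot] {P : ℤ → H →L[ℂ] H}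
    (hP : ∀ a b, calkin (P a) = calkin (P b)) {D : H →L[ℂ] H}
    (h : Tendsto (fun a => ‖P a ∘L D ∘L P a‖) l (𝓝 0)) (b : ℤ) :
    IsCompactOperator (P b ∘L D ∘L P b) := by
  -- The compression at `b` is the norm limit of its differences from the compressions at `a`, and
  -- each difference is compact because the projections agree modulo compacts.
  refine isCompactOperator_of_tendsto (l := l)
    (F := fun a => P b ∘L D ∘L P b - P a ∘L D ∘L P a) ?_ ?_
  · simpa using tendsto_const_nhds.sub (tendsto_zero_iff_norm_tendsto_zero.2 h)
  · refine Eventually.of_forall fun a => ?_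
    refine calkin_eq_iff.1 ?_
    change calkin (P b * (D * P b)) = calkin (P a * (D * P a))
    rw [map_mul, map_mul, map_mul, map_mul, hP a b]

end CellStructure


/-! ### Kernels of block diagonal compressions and the skew part of a unitary. -/

section Walks

variable {S : SymType} {H : Type u} [NormedAddCommGroup H] [InnerProductSpace ℂ H]
  {ρ : SymRep S H}

/-- The kernel, within `K`, of the compression of `B` to `K`. -/
noncomputable def compressionKer (K : Submodule ℂ H) [K.HasOrthogonalProjection] (B : H →L[ℂ] H) :
    Submodule ℂ H :=
  K ⊓ eigenspace (K.starProjection ∘L B ∘L K.starProjection) 0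

theorem SymRep.SkewCompatible.invariant_compressionKer {B : H →L[ℂ] H} (hB : ρ.SkewCompatible B)
    {K : Submodule ℂ H} [K.HasOrthogonalProjection] (hK : ρ.Invariant K) :
    ρ.Invariant (compressionKer K B) :=
  hK.inf (hB.compression hK).invariant_ker

/-- The kernel of a block diagonal operator with a vanishing block `F`. -/
theorem eigenspace_compression_add {K₁ K₂ F : Submodule ℂ H} [K₁.HasOrthogonalProjection]
    [K₂.HasOrthogonalProjection] (h12 : K₁ ⟂ K₂) (h1 : K₁ ⟂ F) (h2 : K₂ ⟂ F)
    (hsum : ∀ x, ∃ z ∈ F, K₁.starProjection x + K₂.starProjection x + z = x)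
    (B₁ B₂ : H →L[ℂ] H) :
    eigenspace (K₁.starProjection ∘L B₁ ∘L K₁.starProjection +
        K₂.starProjection ∘L B₂ ∘L K₂.starProjection) 0 =
      compressionKer K₁ B₁ ⊔ compressionKer K₂ B₂ ⊔ F := by
  have hz : ∀ {K L : Submodule ℂ H} [K.HasOrthogonalProjection] (_ : L ⟂ K) {x : H} (_ : x ∈ L),
      K.starProjection x = 0 := fun h x hx =>
    (Submodule.starProjection_apply_eq_zero_iff _).2 (h hx)
  apply le_antisymm
  · intro x hx
    have hx' : K₁.starProjection (B₁ (K₁.starProjection x)) +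
        K₂.starProjection (B₂ (K₂.starProjection x)) = 0 := mem_eigenspace_zero.1 hx
    have h0 : K₁.starProjection (B₁ (K₁.starProjection x)) = 0 := by
      refine Submodule.disjoint_def.1 h12.disjoint _ (Submodule.starProjection_apply_mem _ _) ?_
      rw [eq_neg_of_add_eq_zero_left hx']
      exact neg_mem (Submodule.starProjection_apply_mem _ _)
    rw [h0, zero_add] at hx'
    obtain ⟨z, hzF, hxz⟩ := hsum x
    rw [← hxz]
    refine add_mem (Submodule.mem_sup_left (Submodule.add_mem_sup ⟨?_, ?_⟩ ⟨?_, ?_⟩))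
      (Submodule.mem_sup_right hzF)
    · exact Submodule.starProjection_apply_mem _ _
    · refine mem_eigenspace_zero.2 ?_
      simp only [ContinuousLinearMap.comp_apply]
      rw [Submodule.starProjection_eq_self_iff.2 (K₁.starProjection_apply_mem x), h0]
    · exact Submodule.starProjection_apply_mem _ _
    · refine mem_eigenspace_zero.2 ?_
      simp only [ContinuousLinearMap.comp_apply]
      rw [Submodule.starProjection_eq_self_iff.2 (K₂.starProjection_apply_mem x), hx']
  · refine sup_le (sup_le ?_ ?_) ?_
    · rintro x ⟨hx, hx0⟩
      refine mem_eigenspace_zero.2 ?_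
      rw [add_apply, mem_eigenspace_zero.1 hx0]
      simp only [ContinuousLinearMap.comp_apply]
      rw [hz h12 hx, map_zero, map_zero, add_zero]
    · rintro x ⟨hx, hx0⟩
      refine mem_eigenspace_zero.2 ?_
      rw [add_apply, mem_eigenspace_zero.1 hx0]
      simp only [ContinuousLinearMap.comp_apply]
      rw [hz h12.symm hx, map_zero, map_zero, add_zero]
    · intro x hx
      refine mem_eigenspace_zero.2 ?_
      simp only [add_apply, ContinuousLinearMap.comp_apply]
      rw [hz h1.symm hx, hz h2.symm hx]
      simp only [map_zero, add_zero]

/-- The kernel is an orthogonal sum of three invariant pieces. The block `F` is `⊥` when both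
half-lines share a cut, and the skipped cell when the cuts are adjacent. -/
theorem SymRep.indexOn_eigenspace_compression_add {K₁ K₂ F : Submodule ℂ H}
    [K₁.HasOrthogonalProjection] [K₂.HasOrthogonalProjection]
    (hK₁ : ρ.Invariant K₁) (hK₂ : ρ.Invariant K₂) (hF : ρ.HasIndexOn F)
    (h12 : K₁ ⟂ K₂) (h1 : K₁ ⟂ F) (h2 : K₂ ⟂ F)
    (hsum : ∀ x, ∃ z ∈ F, K₁.starProjection x + K₂.starProjection x + z = x)
    {B₁ B₂ : H →L[ℂ] H} (hB₁ : ρ.SkewCompatible B₁) (hB₂ : ρ.SkewCompatible B₂)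
    (hu : IsUnit (calkin (K₁.starProjection ∘L B₁ ∘L K₁.starProjection +
        K₂.starProjection ∘L B₂ ∘L K₂.starProjection))) :
    ρ.HasIndexOn (compressionKer K₁ B₁) ∧ ρ.HasIndexOn (compressionKer K₂ B₂) ∧
    ρ.indexOn (eigenspace (K₁.starProjection ∘L B₁ ∘L K₁.starProjection +
        K₂.starProjection ∘L B₂ ∘L K₂.starProjection) 0) =
      ρ.indexOn (compressionKer K₁ B₁) + ρ.indexOn (compressionKer K₂ B₂) + ρ.indexOn F := by
  have hN := ((hB₁.compression hK₁).add (hB₂.compression hK₂)).hasIndexOn_ker hu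
  rw [eigenspace_compression_add h12 h1 h2 hsum] at hN ⊢
  have e1 := hN.mono (le_sup_left.trans le_sup_left) (hB₁.invariant_compressionKer hK₁)
  have e2 := hN.mono (le_sup_right.trans le_sup_left) (hB₂.invariant_compressionKer hK₂)
  refine ⟨e1, e2, ?_⟩
  have d12 : compressionKer K₁ B₁ ⟂ compressionKer K₂ B₂ := h12.mono inf_le_left inf_le_left
  have d3 : compressionKer K₁ B₁ ⊔ compressionKer K₂ B₂ ⟂ F :=
    Submodule.isOrtho_sup_left.2 ⟨h1.mono_left inf_le_left, h2.mono_left inf_le_left⟩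
  rw [(e1.sup e2).indexOn_sup hF d3.disjoint, e1.indexOn_sup e2 d12.disjoint]

theorem CellStructure.BalancedSymmetry.indexOn_cell {𝓒 : CellStructure H}
    (hρ : 𝓒.BalancedSymmetry ρ) (a : ℤ) :
    ρ.HasIndexOn (𝓒.cell a) ∧ ρ.indexOn (𝓒.cell a) = 0 := by
  obtain ⟨h, hb⟩ := hρ
  have hc : ρ.HasIndexOn (𝓒.cell a) := ⟨𝓒.finiteDimensional a, h a⟩
  exact ⟨hc, hc.indexOn_eq.trans (FinRep.index_of_balanced (hb a))⟩

variable [CompleteSpace H]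

/-- The scalar `1 / 2i` does not affect the kernel. Dropping it leaves the skew-adjoint operator,
whose signs under the antilinear symmetries are those of `SymKind.sign`. -/
theorem imKernel_eq (K : Submodule ℂ H) [K.HasOrthogonalProjection] (W : H →L[ℂ] H) :
    imKernel K W = compressionKer K (W - W.adjoint) := by
  rw [imKernel, compressionKer]
  congr 1
  ext x
  have hK : K.starProjection.adjoint = K.starProjection :=
    ((ContinuousLinearMap.eq_adjoint_iff _ _).2
      (fun x y => Submodule.inner_starProjection_left_eq_right _ x y)).symm
  rw [mem_eigenspace_zero, mem_eigenspace_zero, imPart, smul_apply, smul_eq_zero_iff_right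
    (by simp), ContinuousLinearMap.adjoint_comp, ContinuousLinearMap.adjoint_comp, hK]
  simp [sub_eq_zero]

variable {W : H →L[ℂ] H}

theorem SymRep.Symmetric.skewCompatible (hs : ρ.Symmetric W) (hW : W ∈ unitary (H →L[ℂ] H)) :
    ρ.SkewCompatible (W - W.adjoint) where
  skew x y := by
    have := inner_sub_adjoint W x y
    rw [sub_apply, sub_apply, this, neg_neg]
  comm k h x := by
    have := ρ.op_sub_adjoint W hW hs x
    rw [sub_apply, sub_apply]
    cases k with
    | eta => rw [this.1 h, SymKind.sign, one_smul]
    | tau => rw [this.2.1 h, SymKind.sign, neg_smul, one_smul]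
    | gamma => rw [this.2.2 h, SymKind.sign, neg_smul, one_smul]

theorem unitary_adjoint_mul (hW : W ∈ unitary (H →L[ℂ] H)) : W.adjoint * W = 1 := hW.1

theorem unitary_mul_adjoint (hW : W ∈ unitary (H →L[ℂ] H)) : W * W.adjoint = 1 := hW.2

/-- The factorization `W - W⋆ = W⋆ (W - 1) (W + 1)` consists of factors invertible modulo compacts.
-/
theorem EssGapped.isUnit_calkin_sub_adjoint (hg : EssGapped W) (hW : W ∈ unitary (H →L[ℂ] H)) :
    IsUnit (calkin (W - W.adjoint)) := by
  have h1 := essResolvent_iff.1 hg.1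
  have h2 := essResolvent_iff.1 hg.2
  have hu : IsUnit W.adjoint := isUnit_iff_exists.2
    ⟨W, unitary_adjoint_mul hW, unitary_mul_adjoint hW⟩
  have he : W - W.adjoint = W.adjoint * ((W - (1 : ℂ) • ContinuousLinearMap.id ℂ H) *
      (W - (-1 : ℂ) • ContinuousLinearMap.id ℂ H)) := by
    change _ = W.adjoint * ((W - (1 : ℂ) • 1) * (W - (-1 : ℂ) • 1))
    have : W.adjoint * (W * W) = W := by rw [← mul_assoc, unitary_adjoint_mul hW, one_mul]
    have h3 : (W - 1) * (W + 1) = W * W - 1 := by noncomm_ring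
    rw [one_smul, neg_one_smul, sub_neg_eq_add, h3, mul_sub, this, mul_one]
  rw [he, map_mul, map_mul]
  exact (hu.map calkin).mul (h1.mul h2)

/-- Eigenvalues `1` and `-1` are preserved by the symmetries. -/
theorem SymRep.Symmetric.invariant_eigenspace (hs : ρ.Symmetric W)
    (hW : W ∈ unitary (H →L[ℂ] H)) {c : ℝ} (hc : c * c = 1) :
    ρ.Invariant (eigenspace W c) := by
  intro k h x hx
  rw [Module.End.mem_eigenspace_iff, ContinuousLinearMap.coe_coe] at hx ⊢
  have ht : k.twist (c : ℂ) = c := by cases k <;> simp [SymKind.twist]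
  have h1 := hs k h x
  rw [hx, ρ.map_smul, ht] at h1
  have h2 : (c : ℂ) • ρ.op k h x = W.adjoint (ρ.op k h x) → W (ρ.op k h x) = (c : ℂ) • ρ.op k h x := by
    intro h3
    have h4 := congrArg W h3
    have h5 : W (W.adjoint (ρ.op k h x)) = ρ.op k h x :=
      congrArg (fun T : H →L[ℂ] H => T (ρ.op k h x)) (unitary_mul_adjoint hW)
    rw [h5, _root_.map_smul] at h4
    have h6 := congrArg ((c : ℂ) • ·) h4
    simp only [smul_smul, ← Complex.ofReal_mul, hc] at h6
    rwa [Complex.ofReal_one, one_smul] at h6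
  cases k with
  | eta => exact h1.symm
  | tau => exact h2 h1
  | gamma => exact h2 h1

/-- For unitary `W`, `W x = W⋆ x` is equivalent to `W (W x) = x`, and an involution splits `x` into
halves of `x + W x` and `x - W x`. -/
theorem eigenspace_sub_adjoint (hW : W ∈ unitary (H →L[ℂ] H)) :
    eigenspace (W - W.adjoint) 0 = eigenspace W 1 ⊔ eigenspace W (-1) := by
  have e1 : ∀ x, W (W.adjoint x) = x := fun x =>
    congrArg (fun T : H →L[ℂ] H => T x) (unitary_mul_adjoint hW)
  have e2 : ∀ x, W.adjoint (W x) = x := fun x =>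
    congrArg (fun T : H →L[ℂ] H => T x) (unitary_adjoint_mul hW)
  apply le_antisymm
  · intro x hx
    have hx' : W x = W.adjoint x := sub_eq_zero.1 (mem_eigenspace_zero.1 hx)
    have hWW : W (W x) = x := by rw [hx', e1]
    have : x = (1 / 2 : ℂ) • (x + W x) + (1 / 2 : ℂ) • (x - W x) := by module
    rw [this]
    refine Submodule.add_mem_sup (Submodule.smul_mem _ _ ?_) (Submodule.smul_mem _ _ ?_) <;>
      rw [Module.End.mem_eigenspace_iff, ContinuousLinearMap.coe_coe]
    · rw [map_add, hWW, one_smul, add_comm]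
    · rw [map_sub, hWW, neg_one_smul, neg_sub]
  · refine sup_le ?_ ?_ <;> intro x hx <;>
      rw [Module.End.mem_eigenspace_iff, ContinuousLinearMap.coe_coe] at hx <;>
      rw [mem_eigenspace_zero, sub_apply, sub_eq_zero] <;> have h := e2 x
    · rw [hx, one_smul] at h ⊢
      exact h.symm
    · rw [hx, neg_one_smul, map_neg] at h
      rw [hx, neg_one_smul, ← h, neg_neg, h]

theorem SymRep.Admissible.hasIndexOn (hW : ρ.Admissible W) :
    ρ.HasIndexOn (eigenspace W 1) ∧ ρ.HasIndexOn (eigenspace W (-1)) := by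
  have h := (hW.symmetric.skewCompatible hW.unitary).hasIndexOn_ker
    (hW.essGapped.isUnit_calkin_sub_adjoint hW.unitary)
  rw [eigenspace_sub_adjoint hW.unitary] at h
  have i1 := hW.symmetric.invariant_eigenspace hW.unitary (c := 1) (by norm_num)
  have i2 := hW.symmetric.invariant_eigenspace hW.unitary (c := -1) (by norm_num)
  rw [Complex.ofReal_one] at i1
  rw [Complex.ofReal_neg, Complex.ofReal_one] at i2
  exact ⟨h.mono le_sup_left i1, h.mono le_sup_right i2⟩

theorem SymRep.Admissible.si_eq (hW : ρ.Admissible W) :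
    ρ.si W = ρ.indexOn (eigenspace (W - W.adjoint) 0) := by
  rw [eigenspace_sub_adjoint hW.unitary, hW.hasIndexOn.1.indexOn_sup hW.hasIndexOn.2, SymRep.si]
  rw [Submodule.disjoint_def]
  intro x h1 h2
  rw [Module.End.mem_eigenspace_iff] at h1 h2
  rw [h1] at h2
  linear_combination (norm := module) (1 / 2 : ℂ) • h2

namespace CellStructure

variable {𝓒 : CellStructure H}

/-- Multiplying the locality condition by `W` turns it into commutation modulo compacts, where the
cut no longer matters. -/
theorem commute_calkin_of_essLocal (hW : W ∈ unitary (H →L[ℂ] H)) (h : 𝓒.EssLocal W) (a : ℤ) :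
    Commute (calkin W) (calkin (𝓒.Pge a)) := by
  obtain ⟨b, hb⟩ := h
  have h1 : calkin (𝓒.Pge b) = calkin (W.adjoint * (𝓒.Pge b * W)) := calkin_eq_iff.2 hb
  rw [𝓒.calkin_Pge_eq a b]
  rw [Commute, SemiconjBy, ← map_mul, ← map_mul, ← one_mul (𝓒.Pge b * W),
    ← unitary_mul_adjoint hW, mul_assoc, map_mul, map_mul, ← h1]

theorem essLocal_of_commute (hW : W ∈ unitary (H →L[ℂ] H))
    (h : Commute (calkin W) (calkin (𝓒.Pge 0))) : 𝓒.EssLocal W := by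
  refine ⟨0, calkin_eq_iff.1 ?_⟩
  change _ = calkin (W.adjoint * (𝓒.Pge 0 * W))
  rw [map_mul, map_mul, ← h.eq, ← mul_assoc, ← map_mul, unitary_adjoint_mul hW, map_one, one_mul]

theorem commute_calkin_adjoint (hW : W ∈ unitary (H →L[ℂ] H)) {p : Calkin H}
    (h : Commute (calkin W) p) : Commute (calkin W.adjoint) p := by
  have h1 : calkin W.adjoint * calkin W = 1 := by
    rw [← map_mul, unitary_adjoint_mul hW, map_one]
  have h2 : calkin W * calkin W.adjoint = 1 := by
    rw [← map_mul, unitary_mul_adjoint hW, map_one]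
  let u : (Calkin H)ˣ := ⟨calkin W, calkin W.adjoint, h2, h1⟩
  exact Commute.units_inv_left (u := u) h

/-- If `p` commutes with `b`, then `p b p + (1 - p) b (1 - p) = b`; the two cuts may differ since
their projections have the same class. -/
theorem calkin_compression_add (a b : ℤ) (B : H →L[ℂ] H)
    (h : Commute (calkin B) (calkin (𝓒.Pge a))) :
    calkin (𝓒.Plt a ∘L B ∘L 𝓒.Plt a + 𝓒.Pge b ∘L B ∘L 𝓒.Pge b) = calkin B := by
  change calkin (𝓒.Plt a * (B * 𝓒.Plt a) + 𝓒.Pge b * (B * 𝓒.Pge b)) = _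
  have hp : calkin (𝓒.Pge a) * calkin (𝓒.Pge a) = calkin (𝓒.Pge a) := by
    rw [← map_mul, 𝓒.Pge_mul_self]
  rw [map_add, map_mul, map_mul, map_mul, map_mul, 𝓒.calkin_Pge_eq b a, 𝓒.Plt_eq, map_sub, map_one]
  have h1 : calkin (𝓒.Pge a) * (calkin B * calkin (𝓒.Pge a)) = calkin (𝓒.Pge a) * calkin B := by
    rw [h.eq, ← mul_assoc, hp]
  rw [mul_sub, mul_one, sub_mul, one_mul, mul_sub, h1, h.eq]
  abel

end CellStructure

end Walks


/-! ### The numerical value of an index is bounded by the dimension. -/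

section Value

variable {S : SymType}

/-- Up to `n / 2` the least absolute residue is `m` itself, and beyond that it is still at most `n /
2`. -/
theorem natAbs_valMinAbs_natCast_le (n m : ℕ) [NeZero n] :
    ((m : ZMod n).valMinAbs).natAbs ≤ m := by
  by_cases h : m ≤ n / 2
  · rw [ZMod.valMinAbs_natCast_of_le_half h, Int.natAbs_natCast]
  · exact (ZMod.natAbs_valMinAbs_le _).trans (le_of_not_ge h)

theorem SymRep.natAbs_chiralTrace_le {E : Type u} [NormedAddCommGroup E] [InnerProductSpace ℂ E]
    [FiniteDimensional ℂ E] (ρ : SymRep S E) (h : S.Has .gamma) :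
    (ρ.chiralTrace h).natAbs ≤ Module.finrank ℂ E := by
  have h1 := Submodule.finrank_le (Module.End.eigenspace (ρ.chi h) 1)
  have h2 := Submodule.finrank_le (Module.End.eigenspace (ρ.chi h) (-1))
  rw [SymRep.chiralTrace]
  omega

theorem FinRep.indexAbs_index_le (F : FinRep.{u} S) :
    indexAbs F.index ≤ Module.finrank ℂ F.carrier := by
  rw [indexAbs, indexValue_index]
  cases S with
  | A => exact Nat.zero_le _
  | C => exact Nat.zero_le _
  | AI => exact Nat.zero_le _
  | AII => exact Nat.zero_le _
  | CI => exact Nat.zero_le _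
  | AIII => exact F.rep.natAbs_chiralTrace_le _
  | BDI => exact F.rep.natAbs_chiralTrace_le _
  | CII => exact F.rep.natAbs_chiralTrace_le _
  | D => exact natAbs_valMinAbs_natCast_le 2 _
  | DIII => exact natAbs_valMinAbs_natCast_le 4 _

end Value

/-! ### Half-line indices of walks and crossovers. -/

section Walks

variable {S : SymType} {H : Type u} [NormedAddCommGroup H] [InnerProductSpace ℂ H]
  [CompleteSpace H] {ρ : SymRep S H} {W : H →L[ℂ] H} {𝓒 : CellStructure H}

namespace CellStructure

theorem AdmissibleWalk.commute_calkin (hW : 𝓒.AdmissibleWalk ρ W) (a : ℤ) :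
    Commute (calkin W) (calkin (𝓒.Pge a)) :=
  commute_calkin_of_essLocal hW.admissible.unitary hW.essLocal a

theorem AdmissibleWalk.skewCompatible (hW : 𝓒.AdmissibleWalk ρ W) :
    ρ.SkewCompatible (W - W.adjoint) :=
  hW.admissible.symmetric.skewCompatible hW.admissible.unitary

theorem AdmissibleWalk.isUnit_calkin (hW : 𝓒.AdmissibleWalk ρ W) :
    IsUnit (calkin (W - W.adjoint)) :=
  hW.admissible.essGapped.isUnit_calkin_sub_adjoint hW.admissible.unitary

theorem AdmissibleWalk.calkin_compression_add_eq (hW : 𝓒.AdmissibleWalk ρ W) (a b : ℤ) :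
    calkin (𝓒.Plt a ∘L (W - W.adjoint) ∘L 𝓒.Plt a +
      𝓒.Pge b ∘L (W - W.adjoint) ∘L 𝓒.Pge b) = calkin (W - W.adjoint) := by
  apply calkin_compression_add
  rw [map_sub]
  exact (hW.commute_calkin a).sub_left
    (commute_calkin_adjoint hW.admissible.unitary (hW.commute_calkin a))

/-- Splitting a compatible operator at `a`. -/
theorem LocalSymmetry.indexOn_split (hρ : 𝓒.LocalSymmetry ρ) (a : ℤ) {B₁ B₂ : H →L[ℂ] H}
    (hB₁ : ρ.SkewCompatible B₁) (hB₂ : ρ.SkewCompatible B₂)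
    (hu : IsUnit (calkin (𝓒.Plt a ∘L B₁ ∘L 𝓒.Plt a + 𝓒.Pge a ∘L B₂ ∘L 𝓒.Pge a))) :
    ρ.HasIndexOn (compressionKer (𝓒.left a) B₁) ∧ ρ.HasIndexOn (compressionKer (𝓒.right a) B₂) ∧
    ρ.indexOn (eigenspace (𝓒.Plt a ∘L B₁ ∘L 𝓒.Plt a + 𝓒.Pge a ∘L B₂ ∘L 𝓒.Pge a) 0) =
      ρ.indexOn (compressionKer (𝓒.left a) B₁) + ρ.indexOn (compressionKer (𝓒.right a) B₂) := by
  have := ρ.indexOn_eigenspace_compression_add (hρ.invariant_left a) (hρ.invariant_right a)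
    ρ.hasIndexOn_bot (𝓒.left_isOrtho_right le_rfl) Submodule.isOrtho_bot_right
    Submodule.isOrtho_bot_right
    (fun x => ⟨0, zero_mem _, by rw [add_zero, 𝓒.starProjection_left_add_right]⟩) hB₁ hB₂ hu
  rwa [ρ.indexOn_bot, add_zero] at this

/-- The block diagonal part of `W - W⋆` is a compact perturbation of it, and its kernel is the sum
of the two half-line kernels. -/
theorem AdmissibleWalk.si_eq_same (hW : 𝓒.AdmissibleWalk ρ W) (hρ : 𝓒.LocalSymmetry ρ) (a : ℤ) :
    ρ.HasIndexOn (imKernel (𝓒.left a) W) ∧ ρ.HasIndexOn (imKernel (𝓒.right a) W) ∧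
    ρ.si W = 𝓒.leftIndex ρ a W + 𝓒.rightIndex ρ a W := by
  have hc := hW.calkin_compression_add_eq a a
  have hB := hW.skewCompatible
  obtain ⟨h1, h2, h3⟩ := hρ.indexOn_split a hB hB (hc ▸ hW.isUnit_calkin)
  rw [leftIndex, rightIndex, SymRep.siCompression, SymRep.siCompression, imKernel_eq, imKernel_eq]
  refine ⟨h1, h2, ?_⟩
  rw [← h3, hW.admissible.si_eq]
  exact (hB.indexOn_ker_congr ((hB.compression (hρ.invariant_left a)).add
    (hB.compression (hρ.invariant_right a))) hW.isUnit_calkin hc).symm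

theorem AdmissibleWalk.hasHalfIndices (hW : 𝓒.AdmissibleWalk ρ W) (hρ : 𝓒.LocalSymmetry ρ) :
    𝓒.HasHalfIndices ρ W :=
  fun a => ⟨(hW.si_eq_same hρ a).1, (hW.si_eq_same hρ a).2.1⟩

/-- The cuts `a` and `a + 1` leave out exactly the cell at `a`. The decoupled operator vanishes
there, so the whole cell joins the kernel, with index zero by balance. -/
theorem AdmissibleWalk.si_eq_succ (hW : 𝓒.AdmissibleWalk ρ W) (hρ : 𝓒.BalancedSymmetry ρ)
    (a : ℤ) : ρ.si W = 𝓒.leftIndex ρ a W + 𝓒.rightIndex ρ (a + 1) W := by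
  have hc := hW.calkin_compression_add_eq a (a + 1)
  have hB := hW.skewCompatible
  have hl := hρ.1
  have h := ρ.indexOn_eigenspace_compression_add (hl.invariant_left a)
    (hl.invariant_right (a + 1)) (hρ.indexOn_cell a).1 (𝓒.left_isOrtho_right (by omega))
    (𝓒.left_isOrtho_cell a) (𝓒.right_isOrtho_cell a)
    (fun x => ⟨_, Submodule.starProjection_apply_mem _ x, by
      rw [add_assoc, ← 𝓒.starProjection_right_eq, 𝓒.starProjection_left_add_right]⟩) hB hB
    (show IsUnit (calkin _) from hc ▸ hW.isUnit_calkin)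
  rw [leftIndex, rightIndex, SymRep.siCompression, SymRep.siCompression, imKernel_eq, imKernel_eq,
    ← add_zero (ρ.indexOn _ + _), ← (hρ.indexOn_cell a).2, ← h.2.2, hW.admissible.si_eq]
  exact (hB.indexOn_ker_congr ((hB.compression (hl.invariant_left a)).add
    (hB.compression (hl.invariant_right (a + 1)))) hW.isUnit_calkin hc).symm

theorem eq_of_forall_eq_succ {α : Type*} {f : ℤ → α} (h : ∀ a, f a = f (a + 1)) (a b : ℤ) :
    f a = f b := by
  have h0 : ∀ a, f a = f 0 := by
    intro a
    induction a using Int.induction_on with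
    | zero => rfl
    | succ n ih => rw [← h, ih]
    | pred n ih => rw [← ih, h]; congr 1; ring
  rw [h0 a, h0 b]

/-- Decomposing `si W` at the cuts `a, a` and at `a, a + 1` involves the same left index, which
cancels. -/
theorem AdmissibleWalk.rightIndex_eq (hW : 𝓒.AdmissibleWalk ρ W) (hρ : 𝓒.BalancedSymmetry ρ)
    (a b : ℤ) : 𝓒.rightIndex ρ a W = 𝓒.rightIndex ρ b W := by
  refine eq_of_forall_eq_succ (f := fun a => 𝓒.rightIndex ρ a W) (fun a => ?_) a b
  have h := hW.si_eq_succ hρ a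
  rw [(hW.si_eq_same hρ.1 a).2.2] at h
  exact add_left_cancel h

/-- The index of an admissible walk is the sum of its half-line indices at any cut points. -/
theorem AdmissibleWalk.si_eq_left_add_right (hW : 𝓒.AdmissibleWalk ρ W)
    (hρ : 𝓒.BalancedSymmetry ρ) (a b : ℤ) :
    ρ.si W = 𝓒.leftIndex ρ a W + 𝓒.rightIndex ρ b W := by
  rw [hW.rightIndex_eq hρ b a, (hW.si_eq_same hρ.1 a).2.2]

theorem BulkWalk.si_eq_zero (hW : 𝓒.BulkWalk ρ W) : ρ.si W = 0 := by
  have h : ∀ c : ℂ, c ∉ spectrum ℂ W → eigenspace W c = ⊥ := by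
    intro c hc
    rw [Submodule.eq_bot_iff]
    intro x hx
    rw [spectrum.notMem_iff, ContinuousLinearMap.isUnit_iff_bijective] at hc
    refine hc.1 ?_
    rw [map_zero, sub_apply, Algebra.algebraMap_eq_smul_one, sub_eq_zero]
    exact (Module.End.mem_eigenspace_iff.1 hx).symm
  rw [SymRep.si, h 1 hW.gapped.1, h (-1) hW.gapped.2, ρ.indexOn_bot, add_zero]

variable {W' : H →L[ℂ] H}

/-- The right index depends only on the compression to a right half-line, up to compacts. -/
theorem AdmissibleWalk.rightIndex_congr (hW : 𝓒.AdmissibleWalk ρ W)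
    (hW' : 𝓒.AdmissibleWalk ρ W') (hρ : 𝓒.LocalSymmetry ρ) (a : ℤ)
    (hc : calkin (𝓒.Pge a ∘L (W' - W'.adjoint) ∘L 𝓒.Pge a) =
      calkin (𝓒.Pge a ∘L (W - W.adjoint) ∘L 𝓒.Pge a)) :
    𝓒.rightIndex ρ a W' = 𝓒.rightIndex ρ a W := by
  have hB := hW.skewCompatible
  have hB' := hW'.skewCompatible
  have hu := hW.isUnit_calkin
  rw [← hW.calkin_compression_add_eq a a] at hu
  -- A hybrid operator keeps the left block of `W` and takes the right block from `W'`. It is a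
  -- compact perturbation of the block diagonal part of `W`, and the common left index cancels at
  -- the end.
  have he : calkin (𝓒.Plt a ∘L (W - W.adjoint) ∘L 𝓒.Plt a +
      𝓒.Pge a ∘L (W' - W'.adjoint) ∘L 𝓒.Pge a) =
      calkin (𝓒.Plt a ∘L (W - W.adjoint) ∘L 𝓒.Plt a +
      𝓒.Pge a ∘L (W - W.adjoint) ∘L 𝓒.Pge a) := by
    rw [map_add, hc, map_add]
  have h := ((hB.compression (hρ.invariant_left a)).add
    (hB.compression (hρ.invariant_right a))).indexOn_ker_congr
    ((hB.compression (hρ.invariant_left a)).add (hB'.compression (hρ.invariant_right a))) hu he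
  have h1 := (hρ.indexOn_split a hB hB hu).2.2
  have h2 := (hρ.indexOn_split a hB hB' (he ▸ hu)).2.2
  rw [rightIndex, rightIndex, SymRep.siCompression, SymRep.siCompression, imKernel_eq, imKernel_eq]
  exact add_left_cancel ((h2.symm.trans h).trans h1)

/-- The left index depends only on the compression to a left half-line, up to compacts. -/
theorem AdmissibleWalk.leftIndex_congr (hW : 𝓒.AdmissibleWalk ρ W)
    (hW' : 𝓒.AdmissibleWalk ρ W') (hρ : 𝓒.LocalSymmetry ρ) (a : ℤ)
    (hc : calkin (𝓒.Plt a ∘L (W' - W'.adjoint) ∘L 𝓒.Plt a) =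
      calkin (𝓒.Plt a ∘L (W - W.adjoint) ∘L 𝓒.Plt a)) :
    𝓒.leftIndex ρ a W' = 𝓒.leftIndex ρ a W := by
  have hB := hW.skewCompatible
  have hB' := hW'.skewCompatible
  have hu := hW.isUnit_calkin
  rw [← hW.calkin_compression_add_eq a a] at hu
  have he : calkin (𝓒.Plt a ∘L (W' - W'.adjoint) ∘L 𝓒.Plt a +
      𝓒.Pge a ∘L (W - W.adjoint) ∘L 𝓒.Pge a) =
      calkin (𝓒.Plt a ∘L (W - W.adjoint) ∘L 𝓒.Plt a +
      𝓒.Pge a ∘L (W - W.adjoint) ∘L 𝓒.Pge a) := by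
    rw [map_add, hc, map_add]
  have h := ((hB.compression (hρ.invariant_left a)).add
    (hB.compression (hρ.invariant_right a))).indexOn_ker_congr
    ((hB'.compression (hρ.invariant_left a)).add (hB.compression (hρ.invariant_right a))) hu he
  have h1 := (hρ.indexOn_split a hB hB hu).2.2
  have h2 := (hρ.indexOn_split a hB' hB (he ▸ hu)).2.2
  rw [leftIndex, leftIndex, SymRep.siCompression, SymRep.siCompression, imKernel_eq, imKernel_eq]
  exact add_right_cancel ((h2.symm.trans h).trans h1)

/-- If the compressions of two operators by the self-adjoint `P` agree up to compacts, so do those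
of their imaginary parts. -/
theorem calkin_compression_sub_adjoint {P : H →L[ℂ] H} (hP : P.adjoint = P)
    (h : IsCompactOperator (P ∘L (W - W') ∘L P)) :
    calkin (P ∘L (W - W.adjoint) ∘L P) = calkin (P ∘L (W' - W'.adjoint) ∘L P) := by
  rw [calkin_eq_iff]
  have h' := isCompactOperator_adjoint h
  have : P ∘L (W - W.adjoint) ∘L P - P ∘L (W' - W'.adjoint) ∘L P =
      P ∘L (W - W') ∘L P - (P ∘L (W - W') ∘L P).adjoint := by
    rw [ContinuousLinearMap.adjoint_comp, ContinuousLinearMap.adjoint_comp, hP, map_sub]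
    ext x
    simp
    abel
  rw [this]
  exact h.sub h'

/-- If a unitary `W` agrees on the range of `P`, up to compacts, with a unitary `V` which commutes
with `P` up to compacts, then `(1 - P) W P` is compact. -/
theorem calkin_off_diagonal_eq_zero {V P : H →L[ℂ] H} (hW : W ∈ unitary (H →L[ℂ] H))
    (hV : V ∈ unitary (H →L[ℂ] H)) (hP : P.adjoint = P) (hPP : P * P = P)
    (hc : Commute (calkin V) (calkin P)) (h : IsCompactOperator (P ∘L (W - V) ∘L P)) :
    calkin ((1 - P) * (W * P)) = 0 ∧ calkin (P * (W * P)) = calkin V * calkin P := by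
  have hp : calkin P * calkin P = calkin P := by rw [← map_mul, hPP]
  have e1 : calkin (P * (W * P)) = calkin (P * (V * P)) := by
    rw [calkin_eq_iff]
    convert! h using 2
    change _ = P * ((W - V) * P)
    rw [sub_mul, mul_sub]
  have e1' : calkin (P * (W.adjoint * P)) = calkin (P * (V.adjoint * P)) := by
    rw [calkin_eq_iff]
    convert! isCompactOperator_adjoint h using 2
    rw [ContinuousLinearMap.adjoint_comp, ContinuousLinearMap.adjoint_comp, hP, map_sub]
    change _ = (P * (W.adjoint - V.adjoint)) * P
    rw [mul_sub, sub_mul, mul_assoc, mul_assoc]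
  have hc' := commute_calkin_adjoint hV hc
  have e2 : ∀ {v : Calkin H}, Commute v (calkin P) → calkin P * (v * calkin P) = v * calkin P := by
    intro v hv
    rw [← mul_assoc, ← hv.eq, mul_assoc, hp]
  refine ⟨?_, ?_⟩
  · rw [calkin_eq_zero_iff]
    apply isCompactOperator_of_adjoint_comp_self
    rw [← calkin_eq_zero_iff]
    have hQ : (1 - P).adjoint = 1 - P := by
      rw [map_sub, hP]
      congr 1
      exact star_one _
    have hadj : ((1 - P) * (W * P)).adjoint = P * W.adjoint * (1 - P) := by
      have : ((1 - P) * (W * P)).adjoint = (P.adjoint * W.adjoint) * (1 - P).adjoint := by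
        change star ((1 - P) * (W * P)) = (star P * star W) * star (1 - P)
        rw [star_mul, star_mul]
      rw [this, hP, hQ]
    change calkin (((1 - P) * (W * P)).adjoint * ((1 - P) * (W * P))) = 0
    have hQQ : (1 - P) * (1 - P) = 1 - P := by rw [mul_sub, mul_one, sub_mul, one_mul, hPP]; simp
    -- By unitarity of `W`, the off-diagonal block `X = (1 - P) W P` satisfies `X⋆ X = P - (P W⋆ P)
    -- (P W P)`. Modulo compacts `W` may be replaced by `V` here, and then the difference vanishes.
    have : ((1 - P) * (W * P)).adjoint * ((1 - P) * (W * P)) =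
        P - (P * (W.adjoint * P)) * (P * (W * P)) := by
      rw [hadj]
      calc P * W.adjoint * (1 - P) * ((1 - P) * (W * P))
          = P * W.adjoint * ((1 - P) * (1 - P)) * (W * P) := by simp only [mul_assoc]
        _ = P * (W.adjoint * W) * P - P * W.adjoint * P * (W * P) := by
          rw [hQQ]
          noncomm_ring
        _ = P - P * W.adjoint * (P * P) * (W * P) := by
          rw [unitary_adjoint_mul hW, mul_one, hPP]
        _ = _ := by simp only [mul_assoc]
    rw [this, map_sub, map_mul, e1, e1', map_mul, map_mul, map_mul, map_mul, e2 hc, e2 hc',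
      mul_assoc, e2 hc, ← mul_assoc, ← map_mul, unitary_adjoint_mul hV, map_one, one_mul, sub_self]
  · rw [e1, map_mul, map_mul, e2 hc]

/-- A unitary crossover of two admissible walks is an admissible walk. -/
theorem admissibleWalk_of_crossover {W_L W_R : H →L[ℂ] H} (hL : 𝓒.AdmissibleWalk ρ W_L)
    (hR : 𝓒.AdmissibleWalk ρ W_R) (hW : W ∈ unitary (H →L[ℂ] H)) (hs : ρ.Symmetric W)
    (hright : IsCompactOperator (𝓒.Pge 0 ∘L (W - W_R) ∘L 𝓒.Pge 0))
    (hleft : IsCompactOperator (𝓒.Plt 0 ∘L (W - W_L) ∘L 𝓒.Plt 0)) :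
    𝓒.AdmissibleWalk ρ W := by
  set P := 𝓒.Pge 0 with hP
  have hPP : P * P = P := 𝓒.Pge_mul_self 0
  have hp : calkin P * calkin P = calkin P := by rw [← map_mul, hPP]
  have hLc := hL.commute_calkin 0
  have hRc := hR.commute_calkin 0
  have hq : calkin (𝓒.Plt 0) = 1 - calkin P := by rw [𝓒.Plt_eq, map_sub, map_one]
  have hLc' : Commute (calkin W_L) (calkin (𝓒.Plt 0)) := by
    rw [hq]
    exact (Commute.one_right _).sub_right hLc
  have r := calkin_off_diagonal_eq_zero hW hR.admissible.unitary (𝓒.Pge_adjoint 0) hPP hRc hright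
  have l := calkin_off_diagonal_eq_zero hW hL.admissible.unitary (𝓒.Plt_adjoint 0)
    (𝓒.Plt_mul_self 0) hLc' hleft
  -- Both off-diagonal blocks vanish in the Calkin algebra, and each diagonal block is that of the
  -- corresponding bulk walk.
  have hw : calkin W = calkin W_R * calkin P + calkin W_L * (1 - calkin P) := by
    have hPQ : P + 𝓒.Plt 0 = 1 := by rw [𝓒.Plt_eq]; abel
    have h1 : (1 - 𝓒.Plt 0) = P := by rw [𝓒.Plt_eq]; abel
    have h2 : (1 - P) = 𝓒.Plt 0 := (𝓒.Plt_eq 0).symm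
    rw [← r.2, ← hq, ← l.2]
    have hdec : W = (P * (W * P) + (1 - P) * (W * P)) +
        (𝓒.Plt 0 * (W * 𝓒.Plt 0) + (1 - 𝓒.Plt 0) * (W * 𝓒.Plt 0)) := by
      rw [← add_mul, ← add_mul, add_sub_cancel, add_sub_cancel, one_mul, one_mul, ← mul_add, hPQ,
        mul_one]
    conv_lhs => rw [hdec]
    rw [map_add, map_add, map_add, r.1, l.1, add_zero, add_zero]
  have hgap : ∀ c : ℂ, EssResolvent W_L c → EssResolvent W_R c → EssResolvent W c := by
    intro c h1 h2
    rw [essResolvent_iff]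
    have hcc : ∀ x : Calkin H, Commute (calkin (c • ContinuousLinearMap.id ℂ H)) x := by
      intro x
      obtain ⟨T, rfl⟩ := calkin_surjective x
      rw [Commute, SemiconjBy, ← map_mul, ← map_mul]
      congr 1
      ext y
      simp
    have := isUnit_mul_add_mul_one_sub hp (essResolvent_iff.1 h2) (essResolvent_iff.1 h1)
      (by rw [map_sub]; exact hRc.sub_left (hcc _)) (by rw [map_sub]; exact hLc.sub_left (hcc _))
    have he : calkin (W - c • ContinuousLinearMap.id ℂ H) =
        calkin (W_R - c • ContinuousLinearMap.id ℂ H) * calkin P +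
          calkin (W_L - c • ContinuousLinearMap.id ℂ H) * (1 - calkin P) := by
      rw [map_sub, map_sub, map_sub, hw]
      noncomm_ring
    rw [he]
    exact this
  refine ⟨⟨hW, hs, hgap 1 hL.admissible.essGapped.1 hR.admissible.essGapped.1,
    hgap (-1) hL.admissible.essGapped.2 hR.admissible.essGapped.2⟩, essLocal_of_commute hW ?_⟩
  rw [hw]
  have hpp : Commute (calkin P) (calkin P) := Commute.refl _
  exact (hRc.mul_left hpp).add_left (hLc.mul_left ((Commute.one_left _).sub_left hpp))

end CellStructure

end Walks

end QWalk

/-! ### The bulk-boundary correspondence. -/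

theorem mainTheorem5 {S : QWalk.SymType} {H : Type u} [NormedAddCommGroup H]
    [InnerProductSpace ℂ H] [CompleteSpace H]
    (𝓒 : QWalk.CellStructure H) (ρ : QWalk.SymRep S H) (hρ : 𝓒.BalancedSymmetry ρ)
    (W_L W_R W : H →L[ℂ] H)
    (hL : 𝓒.BulkWalk ρ W_L) (hR : 𝓒.BulkWalk ρ W_R)
    (hW : W ∈ unitary (H →L[ℂ] H)) (hWsymm : ρ.Symmetric W)
    (hright : Tendsto (fun a : ℤ => ‖𝓒.Pge a ∘L (W - W_R) ∘L 𝓒.Pge a‖) atTop (𝓝 0))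
    (hleft : Tendsto (fun a : ℤ => ‖𝓒.Plt a ∘L (W - W_L) ∘L 𝓒.Plt a‖) atBot (𝓝 0)) :
    -- the crossover is an admissible walk, and all indices involved are defined
    𝓒.AdmissibleWalk ρ W ∧
    (ρ.HasIndexOn (QWalk.eigenspace W 1) ∧ ρ.HasIndexOn (QWalk.eigenspace W (-1))) ∧
    (𝓒.HasHalfIndices ρ W ∧ 𝓒.HasHalfIndices ρ W_L ∧ 𝓒.HasHalfIndices ρ W_R) ∧
    -- the index of the crossover, whatever cut points are used for the half-line indices
    (∀ a b c d : ℤ,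
      ρ.si W = 𝓒.leftIndex ρ a W + 𝓒.rightIndex ρ b W ∧
      𝓒.leftIndex ρ a W + 𝓒.rightIndex ρ b W =
        -𝓒.rightIndex ρ c W_L + 𝓒.rightIndex ρ d W_R) ∧
    -- different bulk indices enforce eigenvectors
    (∀ c d : ℤ, 𝓒.rightIndex ρ c W_L ≠ 𝓒.rightIndex ρ d W_R →
      ρ.si W ≠ 0 ∧ ∃ ψ : H, ψ ≠ 0 ∧ (W ψ = ψ ∨ W ψ = -ψ)) ∧
    -- the lower bound on the dimension of the combined eigenspaces
    (∀ c d : ℤ, QWalk.indexAbs (-𝓒.rightIndex ρ c W_L + 𝓒.rightIndex ρ d W_R) ≤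
      Module.finrank ℂ (QWalk.eigenspace W 1 ⊔ QWalk.eigenspace W (-1) : Submodule ℂ H)) := by
  have hPge := 𝓒.calkin_Pge_eq
  have hPlt : ∀ a b, QWalk.calkin (𝓒.Plt a) = QWalk.calkin (𝓒.Plt b) := fun a b => by
    rw [𝓒.Plt_eq, 𝓒.Plt_eq, map_sub, map_sub, hPge a b]
  have hcr := QWalk.CellStructure.isCompactOperator_of_tendsto_compression hPge hright
  have hcl := QWalk.CellStructure.isCompactOperator_of_tendsto_compression hPlt hleft
  have hA := QWalk.CellStructure.admissibleWalk_of_crossover hL.walk hR.walk hW hWsymm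
    (hcr 0) (hcl 0)
  have hadd : ∀ a b : ℤ, ρ.si W = 𝓒.leftIndex ρ a W + 𝓒.rightIndex ρ b W :=
    hA.si_eq_left_add_right hρ
  have hr0 : 𝓒.rightIndex ρ 0 W = 𝓒.rightIndex ρ 0 W_R :=
    hR.walk.rightIndex_congr hA hρ.1 0
      (QWalk.CellStructure.calkin_compression_sub_adjoint (𝓒.Pge_adjoint 0) (hcr 0))
  have hl0 : 𝓒.leftIndex ρ 0 W = 𝓒.leftIndex ρ 0 W_L :=
    hL.walk.leftIndex_congr hA hρ.1 0
      (QWalk.CellStructure.calkin_compression_sub_adjoint (𝓒.Plt_adjoint 0) (hcl 0))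
  have hsi : ∀ c d : ℤ, ρ.si W = -𝓒.rightIndex ρ c W_L + 𝓒.rightIndex ρ d W_R := by
    intro c d
    have h0 := hL.walk.si_eq_left_add_right hρ 0 c
    -- The gap of `W_L` makes its left and right indices opposite, which turns the left index of the
    -- crossover into minus a right index.
    rw [hL.si_eq_zero] at h0
    rw [hadd 0 0, hr0, hl0, hR.walk.rightIndex_eq hρ 0 d, eq_neg_of_add_eq_zero_left h0.symm]
  refine ⟨hA, hA.admissible.hasIndexOn, ⟨hA.hasHalfIndices hρ.1, hL.walk.hasHalfIndices hρ.1,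
    hR.walk.hasHalfIndices hρ.1⟩, fun a b c d => ⟨hadd a b, (hadd a b).symm.trans (hsi c d)⟩, ?_, ?_⟩
  · intro c d hne
    have h0 : ρ.si W ≠ 0 := by
      rw [hsi c d, neg_add_eq_sub, sub_ne_zero]
      exact hne.symm
    refine ⟨h0, ?_⟩
    by_contra! hno
    have hbot : ∀ z : ℂ, (∀ x, W x = z • x → W x = x ∨ W x = -x) → QWalk.eigenspace W z = ⊥ := by
      intro z hz
      rw [Submodule.eq_bot_iff]
      intro x hx
      by_contra hx0
      exact (hz x (Module.End.mem_eigenspace_iff.1 hx)).elim (hno x hx0).1 (hno x hx0).2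
    refine h0 ?_
    rw [QWalk.SymRep.si, hbot 1 fun x hx => Or.inl (by rw [hx, one_smul]),
      hbot (-1) fun x hx => Or.inr (by rw [hx, neg_one_smul]), ρ.indexOn_bot, add_zero]
  · intro c d
    have hI := hA.admissible.hasIndexOn.1.sup hA.admissible.hasIndexOn.2
    -- The index is carried by the representation on the joint eigenspace itself, so its absolute
    -- value is at most the dimension of that space.
    rw [← hsi c d, hA.admissible.si_eq, QWalk.eigenspace_sub_adjoint hW, hI.indexOn_eq]
    exact hI.toFinRep.indexAbs_index_le
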